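/- Let $K$ be a field of characteristic $0$ and let $X$ be a linearly ordered set (for instance $X=\{x_1,x_2,\dots\}$ ordered by index). A (not necessarily associative) $K$-algebra is called metabelian Lie-admissible if it satisfies the identities $$(ab)c-(ba)c-c(ab)+c(ba)+(bc)a-(cb)a-a(bc)+a(cb)+(ca)b-(ac)b-b(ca)+b(ac)=0,\qquad (ab)(cd)=0 .$$ Let $F$ be the free metabelian Lie-admissible $K$-algebra generated by $X$, and put $[a,b]=ab-ba$ and $\{a,b\}=ab+ba$. For $n\ge 1$ consider sequences $T=(*^1_{y_1},\dots,*^{n-1}_{y_{n-1}},y_n)$ with $y_1,\dots,y_n\in X$ and each $*^k$ either black ($\bullet$) or white ($\circ$); such a sequence is the same thing as a right comb (binary tree) with $n$ leaves $y_1,\dots,y_n$ and coloured inner vertices. To $T$ we assign the right-normed monomial $$m_T=y_1*^1(y_2*^2(\cdots(y_{n-1}*^{n-1}y_n)\cdots))\in F,\qquad a\bullet b=[a,b],\quad a\circ b=\{a,b\}.$$ Let $\mathcal T$ be the set of all such sequences (for all $n\ge1$) that satisfy the following conditions. 1. If $*^k,\dots,*^{l-1}$ are black and a white vertex occurs immediately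 after them ($*^{l}=\circ$, $l\le n-1$), then $y_k\ge y_{k+1}\ge\dots\ge y_{l-1}$. 2. If $n\ge2$ and $*^{n-1}$ is white, then $y_{n-1}\le y_n$. 3. If the maximal run of consecutive black vertices ending at the last inner vertex is $*^k,\dots,*^{n-1}$ and has more than two vertices, then $y_k\ge y_{k+1}\ge\dots\ge y_{n-1}<y_n$. 4. If that maximal final run $*^k,\dots,*^{n-1}$ has one or two vertices, then $y_{n-1}<y_n$ and the Lie monomial $[y_{n-1},y_n]$, respectively $[y_{n-2},[y_{n-1},y_n]]$, is, up to interchanging the two factors of some of its brackets, a Lyndon–Shirshov basis monomial (of degree $2$, respectively $3$) of the free Lie algebra on $X$. Here a Lyndon–Shirshov word is a nonempty word that strictly precedes lexicographically each of its nontrivial cyclic rotations, and the Lyndon–Shirshov basis monomials are defined recursively: the letters, and $[[u],[v]]$ where $w=uv$ is a Lyndon–Shirshov word of length at least $2$, $v$ is its longest proper Lyndon–Shirshov suffix, and $[u],[v]$ are the Lyndon–Shirshov basis monomials of the words $u,v$. The letters may be ordered either by the given order of $X$ or by the opposite order (the two usual conventions). Then, for either convention, the family of monomials $\mathcal M=(m_T)_{T\in\mathcal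 T}$ is a basis of the vector space $F$; in particular, distinct elements of $\mathcal T$ give distinct monomials. -/

import Mathlib

/-! ### The identities -/

section Identities

variable {A : Type*} [NonUnitalNonAssocRing A]

/-- The left-hand side of the Lie-admissible identity, i.e. the Jacobian of `ab - ba`. -/
def lieAdmissibleExpr (a b c : A) : A :=
  (a * b) * c - (b * a) * c - c * (a * b) + c * (b * a)
    + (b * c) * a - (c * b) * a - a * (b * c) + a * (c * b)
    + (c * a) * b - (a * c) * b - b * (c * a) + b * (a * c)

/-- The left-hand side of the metabelian identity. -/
def metabelianExpr (a b c d : A) : A := (a * b) * (c * d)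

/-- The commutator `[a, b] = ab - ba`. -/
def polComm (a b : A) : A := a * b - b * a

/-- The anticommutator `{a, b} = ab + ba`. -/
def polAnti (a b : A) : A := a * b + b * a

end Identities

/-! ### The free metabelian Lie-admissible algebra -/

/-- A linear subspace that is a two-sided ideal. -/
def IsIdealSubspace {K A : Type*} [Field K] [NonUnitalNonAssocRing A] [Module K A]
    (I : Submodule K A) : Prop :=
  ∀ a x : A, x ∈ I → a * x ∈ I ∧ x * a ∈ I

/-- The two-sided algebra ideal generated by a set. -/
def idealGenerated (K : Type*) {A : Type*} [Field K] [NonUnitalNonAssocRing A] [Module K A]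
    (S : Set A) : Submodule K A :=
  sInf {I : Submodule K A | S ⊆ (I : Set A) ∧ IsIdealSubspace I}

theorem idealGenerated_isIdealSubspace (K : Type*) {A : Type*} [Field K]
    [NonUnitalNonAssocRing A] [Module K A] (S : Set A) :
    IsIdealSubspace (idealGenerated K S) := by
  intro a x hx
  simp only [idealGenerated, Submodule.mem_sInf, Set.mem_ofPred_eq] at hx ⊢
  exact ⟨fun I hI => (hI.2 a x (hx I hI)).1, fun I hI => (hI.2 a x (hx I hI)).2⟩

/-- The ideal of the free nonassociative algebra generated by all values of the
Lie-admissible and metabelian identities. -/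
noncomputable def mLieAdmIdeal (K X : Type*) [Field K] :
    Submodule K (FreeNonUnitalNonAssocAlgebra K X) :=
  idealGenerated K
    ({z | ∃ a b c, z = lieAdmissibleExpr a b c} ∪ {z | ∃ a b c d, z = metabelianExpr a b c d})

/-- The free metabelian Lie-admissible `K`-algebra on the set `X`. -/
def FreeMLieAdm (K X : Type*) [Field K] : Type _ :=
  FreeNonUnitalNonAssocAlgebra K X ⧸ mLieAdmIdeal K X

namespace FreeMLieAdm

variable (K : Type*) {X : Type*} [Field K]

noncomputable instance : AddCommGroup (FreeMLieAdm K X) :=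
  inferInstanceAs (AddCommGroup (FreeNonUnitalNonAssocAlgebra K X ⧸ mLieAdmIdeal K X))

noncomputable instance : Module K (FreeMLieAdm K X) :=
  inferInstanceAs (Module K (FreeNonUnitalNonAssocAlgebra K X ⧸ mLieAdmIdeal K X))

/-- The quotient map. -/
noncomputable def mk : FreeNonUnitalNonAssocAlgebra K X →ₗ[K] FreeMLieAdm K X :=
  (mLieAdmIdeal K X).mkQ

variable {K}

theorem mk_surjective : Function.Surjective (mk K : _ → FreeMLieAdm K X) :=
  (mLieAdmIdeal K X).mkQ_surjective

theorem mk_eq_mk {a b : FreeNonUnitalNonAssocAlgebra K X} :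
    mk K a = mk K b ↔ a - b ∈ mLieAdmIdeal K X :=
  Submodule.Quotient.eq _

noncomputable instance : Mul (FreeMLieAdm K X) where
  mul := Quotient.map₂ (· * ·) (by
    intro a a' ha b b' hb
    replace ha : a - a' ∈ mLieAdmIdeal K X := (Submodule.quotientRel_def _).1 ha
    replace hb : b - b' ∈ mLieAdmIdeal K X := (Submodule.quotientRel_def _).1 hb
    refine (Submodule.quotientRel_def _).2 ?_
    have hI := idealGenerated_isIdealSubspace K
      ({z | ∃ a b c : FreeNonUnitalNonAssocAlgebra K X, z = lieAdmissibleExpr a b c}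
        ∪ {z | ∃ a b c d, z = metabelianExpr a b c d})
    have h : a * b - a' * b' = (a - a') * b + a' * (b - b') := by
      rw [sub_mul, mul_sub]; abel
    rw [h]
    exact Submodule.add_mem _ (hI b _ ha).2 (hI a' _ hb).1)

theorem mk_mul (a b : FreeNonUnitalNonAssocAlgebra K X) : mk K (a * b) = mk K a * mk K b :=
  rfl

noncomputable instance : NonUnitalNonAssocRing (FreeMLieAdm K X) where
  left_distrib a b c := by
    obtain ⟨a, rfl⟩ := mk_surjective a
    obtain ⟨b, rfl⟩ := mk_surjective b
    obtain ⟨c, rfl⟩ := mk_surjective c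
    simp only [← mk_mul, ← map_add, mul_add]
  right_distrib a b c := by
    obtain ⟨a, rfl⟩ := mk_surjective a
    obtain ⟨b, rfl⟩ := mk_surjective b
    obtain ⟨c, rfl⟩ := mk_surjective c
    simp only [← mk_mul, ← map_add, add_mul]
  zero_mul a := by
    obtain ⟨a, rfl⟩ := mk_surjective a
    rw [← map_zero (mk K), ← mk_mul, zero_mul]
  mul_zero a := by
    obtain ⟨a, rfl⟩ := mk_surjective a
    rw [← map_zero (mk K), ← mk_mul, mul_zero]

instance : IsScalarTower K (FreeMLieAdm K X) (FreeMLieAdm K X) where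
  smul_assoc k a b := by
    obtain ⟨a, rfl⟩ := mk_surjective a
    obtain ⟨b, rfl⟩ := mk_surjective b
    simp only [smul_eq_mul, ← mk_mul, ← map_smul, smul_mul_assoc]

instance : SMulCommClass K (FreeMLieAdm K X) (FreeMLieAdm K X) where
  smul_comm k a b := by
    obtain ⟨a, rfl⟩ := mk_surjective a
    obtain ⟨b, rfl⟩ := mk_surjective b
    simp only [smul_eq_mul, ← mk_mul, ← map_smul, mul_smul_comm]

variable (K)

/-- The free generators. -/
noncomputable def gen (x : X) : FreeMLieAdm K X :=
  mk K (FreeNonUnitalNonAssocAlgebra.of K x)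

end FreeMLieAdm

/-! ### Trees with black and white vertices -/

/-- The two types of inner vertices: black is the commutator, white the anticommutator. -/
inductive Dot
  | black
  | white

/-- The right comb with `n = dots.length + 1` leaves that corresponds to the sequence
`(*_{x₁}, …, *_{xₙ₋₁}, xₙ)`: `dots` lists the coloured inner vertices from the root down,
each with the generator on its left leaf, and `last` is the rightmost leaf. -/
structure DotTree (X : Type*) where
  dots : List (Dot × X)
  last : X

/-- The operation at a vertex. -/
def Dot.op {A : Type*} [NonUnitalNonAssocRing A] : Dot → A → A → A
  | Dot.black => polComm
  | Dot.white => polAnti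

/-- The right-normed monomial `x₁ * (x₂ * (… (xₙ₋₁ * xₙ)…))` of a tree. -/
noncomputable def DotTree.monomial (K : Type*) {X : Type*} [Field K] (t : DotTree X) :
    FreeMLieAdm K X :=
  t.dots.foldr (fun e m => e.1.op (FreeMLieAdm.gen K e.2) m) (FreeMLieAdm.gen K t.last)

/-! ### Lyndon–Shirshov words and their standard bracketing -/

/-- Lyndon–Shirshov words with respect to the order `r` of the letters: nonempty words that
strictly precede, lexicographically, each of their nontrivial cyclic rotations. -/
def IsLSWord {X : Type*} (r : X → X → Prop) (w : List X) : Prop :=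
  w ≠ [] ∧ ∀ u v : List X, u ≠ [] → v ≠ [] → w = u ++ v → List.Lex r (u ++ v) (v ++ u)

/-- The word of leaves of a nonassociative monomial. -/
def leafWord {X : Type*} : FreeMagma X → List X
  | FreeMagma.of x => [x]
  | FreeMagma.mul a b => leafWord a ++ leafWord b

/-- Nonassociative Lyndon–Shirshov words (the Lyndon–Shirshov basis of the free Lie algebra):
a letter, or `[u][v]` where `uv` is a Lyndon–Shirshov word and `v` is its longest proper
Lyndon–Shirshov suffix. -/
inductive IsLSMonomial {X : Type*} (r : X → X → Prop) : FreeMagma X → Prop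
  | of (x : X) : IsLSMonomial r (FreeMagma.of x)
  | mul (a b : FreeMagma X) (ha : IsLSMonomial r a) (hb : IsLSMonomial r b)
      (hab : IsLSWord r (leafWord a ++ leafWord b))
      (hmax : ∀ u v : List X, u ≠ [] → leafWord a ++ leafWord b = u ++ v → IsLSWord r v →
        v.length ≤ (leafWord b).length) :
      IsLSMonomial r (a * b)

/-- Two nonassociative monomials differ by interchanging the two factors of some of their
subproducts, so that by anticommutativity their values in a Lie algebra agree up to sign. -/
inductive SwapEquiv {X : Type*} : FreeMagma X → FreeMagma X → Prop
  | of (x : X) : SwapEquiv (FreeMagma.of x) (FreeMagma.of x)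
  | same {a a' b b' : FreeMagma X} : SwapEquiv a a' → SwapEquiv b b' →
      SwapEquiv (a * b) (a' * b')
  | swap {a a' b b' : FreeMagma X} : SwapEquiv a a' → SwapEquiv b b' →
      SwapEquiv (a * b) (b' * a')

/-- The right-normed nonassociative monomial on the generators of `u`, followed by `y`. -/
def rightNormedMagma {X : Type*} (u : List (Dot × X)) (y : X) : FreeMagma X :=
  u.foldr (fun e m => FreeMagma.of e.2 * m) (FreeMagma.of y)

/-! ### The conditions on trees -/

section Conditions

variable {X : Type*} [LinearOrder X]

/-- `u` consists of black dots only. -/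
def AllBlack (u : List (Dot × X)) : Prop := ∀ e ∈ u, e.1 = Dot.black

/-- The generators of the dots in `u` are weakly decreasing. -/
def GensDecreasing (u : List (Dot × X)) : Prop := u.Pairwise (fun e f => e.2 ≥ f.2)

/-- The generator of the last dot of `u` (if any) is smaller than `y`. -/
def LastLT (u : List (Dot × X)) (y : X) : Prop := ∀ e ∈ u.getLast?, e.2 < y

/-- `u` is the maximal run of black dots that reaches the rightmost vertex of `t`. -/
def IsFinalBlackRun (t : DotTree X) (u : List (Dot × X)) : Prop :=
  ∃ a, t.dots = a ++ u ∧ AllBlack u ∧ ∀ e ∈ a.getLast?, e.1 = Dot.white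

/-- Condition (1): in a run of black dots that is followed by a white dot, the generators are
weakly decreasing. -/
def DotTree.Cond1 (t : DotTree X) : Prop :=
  ∀ (a u b : List (Dot × X)) (y : X), t.dots = a ++ u ++ (Dot.white, y) :: b →
    AllBlack u → GensDecreasing u

/-- Condition (2): if the rightmost vertex is white, then `iₙ₋₁ ≤ iₙ`. -/
def DotTree.Cond2 (t : DotTree X) : Prop :=
  ∀ (a : List (Dot × X)) (y : X), t.dots = a ++ [(Dot.white, y)] → y ≤ t.last

/-- Condition (3): if the final run of black dots has more than two dots, then
`i_k ≥ … ≥ iₙ₋₁ < iₙ`. -/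
def DotTree.Cond3 (t : DotTree X) : Prop :=
  ∀ u, IsFinalBlackRun t u → 2 < u.length → GensDecreasing u ∧ LastLT u t.last

/-- Condition (4): if the final run of black dots has one or two dots, then its monomial is,
up to interchanging factors, a Lyndon–Shirshov basis monomial of the free Lie algebra
(of degree 2 or 3), written with `iₙ₋₁ < iₙ`. -/
def DotTree.Cond4 (r : X → X → Prop) (t : DotTree X) : Prop :=
  ∀ u, IsFinalBlackRun t u → 1 ≤ u.length → u.length ≤ 2 →
    LastLT u t.last ∧ ∃ m, IsLSMonomial r m ∧ SwapEquiv (rightNormedMagma u t.last) m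

/-- The trees that satisfy conditions (1)–(4), where Lyndon–Shirshov words are taken with
respect to the order `r` of the letters. -/
def admissibleTrees (r : X → X → Prop) : Set (DotTree X) :=
  {t | t.Cond1 ∧ t.Cond2 ∧ t.Cond3 ∧ t.Cond4 r}

end Conditions

/-! ### Lyndon–Shirshov monomials of degree two and three -/

section LyndonShirshov

variable {X : Type*}

/-! Since `2` is invertible, the product is equivalent to the pair commutator, anticommutator. The
Jacobi identity together with `F² F² = 0` makes the black operators `[x, ·]` commute on `F²`, while
no relation binds the white operators `{x, ·}`. Every black run above a white vertex can therefore
be sorted, and only a final black run needs the theory of free metabelian Lie algebras.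

Spanning: insertion sort handles the runs above a white dot (`exists_insert_black`). Jacobi brings
the smallest generator of an all-black tree into the last bracket (`polComm_standardRun`). The
resulting span is closed under multiplication (`normalSpan_eq_top`).

Independence: `F` is mapped to an explicit algebra whose square is a free module over commuting
black and free white operators, with base elements `e_z` and unordered pairs `s(y, z)`. There `{y,
z}` is `s(y, z)` and, as in the Magnus embedding, `[y, z] = y e_z - z e_y`. A tree ending in black
thus becomes a difference of two basis vectors. A projection `keptProj` kills exactly one of them,
and the survivors of distinct trees are distinct (`exists_leadingTerm`, `LeadingTerm.injective`).

The Lyndon–Shirshov convention matters only for final runs `[x, [y, z]]` with `y < z`: one order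
demands `x ≤ z`, the other `y ≤ x`. A proposition `p` selects between them, so that both cases share
one proof. -/

theorem isLSWord_pair_iff (r : X → X → Prop) [Std.Irrefl r] (y z : X) :
    IsLSWord r [y, z] ↔ r y z := by
  constructor
  · intro h
    have := h.2 [y] [z] (by simp) (by simp) rfl
    simp only [List.cons_append, List.nil_append] at this
    cases this with
    | rel h => exact h
    | cons h =>
      cases h with
      | rel h => exact h
      | cons h => cases h
  · intro h
    refine ⟨by simp, ?_⟩
    rintro (_ | ⟨a, _ | ⟨b, u⟩⟩) v hu hv e
    · exact absurd rfl hu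
    · simp only [List.cons_append, List.nil_append, List.cons.injEq] at e
      obtain ⟨rfl, rfl⟩ := e
      exact .rel h
    · simp only [List.cons_append, List.cons.injEq] at e
      have h3 := e.2.2.symm
      simp only [List.append_eq_nil_iff] at h3
      exact absurd h3.2 hv

theorem isLSWord_triple_iff (r : X → X → Prop) (x y z : X) :
    IsLSWord r [x, y, z] ↔ List.Lex r [x, y, z] [y, z, x] ∧ List.Lex r [x, y, z] [z, x, y] := by
  constructor
  · intro h
    exact ⟨h.2 [x] [y, z] (by simp) (by simp) rfl, h.2 [x, y] [z] (by simp) (by simp) rfl⟩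
  · rintro ⟨h1, h2⟩
    refine ⟨by simp, ?_⟩
    rintro (_ | ⟨a, _ | ⟨b, _ | ⟨c, u⟩⟩⟩) v hu hv e
    · exact absurd rfl hu
    · simp only [List.cons_append, List.nil_append, List.cons.injEq] at e
      obtain ⟨rfl, rfl⟩ := e
      exact h1
    · simp only [List.cons_append, List.nil_append, List.cons.injEq] at e
      obtain ⟨rfl, rfl, rfl⟩ := e
      exact h2
    · simp only [List.cons_append, List.cons.injEq] at e
      have h3 := e.2.2.2.symm
      simp only [List.append_eq_nil_iff] at h3
      exact absurd h3.2 hv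

theorem IsLSMonomial.isLSWord {r : X → X → Prop} {a b : FreeMagma X}
    (h : IsLSMonomial r (a * b)) : IsLSWord r (leafWord a ++ leafWord b) := by
  cases h; assumption

theorem IsLSMonomial.right {r : X → X → Prop} {a b : FreeMagma X}
    (h : IsLSMonomial r (a * b)) : IsLSMonomial r b := by
  cases h; assumption

theorem IsLSMonomial.left {r : X → X → Prop} {a b : FreeMagma X}
    (h : IsLSMonomial r (a * b)) : IsLSMonomial r a := by
  cases h; assumption

theorem IsLSMonomial.suffix_le {r : X → X → Prop} {a b : FreeMagma X}
    (h : IsLSMonomial r (a * b)) : ∀ u v : List X, u ≠ [] → leafWord a ++ leafWord b = u ++ v →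
      IsLSWord r v → v.length ≤ (leafWord b).length := by
  cases h; assumption

theorem isLSMonomial_pair (r : X → X → Prop) [Std.Irrefl r] {y z : X} (h : r y z) :
    IsLSMonomial r (FreeMagma.of y * FreeMagma.of z) := by
  refine .mul _ _ (.of y) (.of z) ((isLSWord_pair_iff r y z).2 h) ?_
  intro u v hu e _
  have := congrArg List.length e
  have := List.length_pos_of_ne_nil hu
  simp [leafWord] at *
  omega

theorem SwapEquiv.eq_of_of {x : X} {m : FreeMagma X} (h : SwapEquiv (FreeMagma.of x) m) :
    m = FreeMagma.of x := by
  cases h; rfl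

theorem SwapEquiv.mul_cases {a b m : FreeMagma X} (h : SwapEquiv (a * b) m) :
    ∃ a' b', SwapEquiv a a' ∧ SwapEquiv b b' ∧ (m = a' * b' ∨ m = b' * a') := by
  cases h with
  | same h h' => exact ⟨_, _, h, h', .inl rfl⟩
  | swap h h' => exact ⟨_, _, h, h', .inr rfl⟩

theorem SwapEquiv.triple_cases {x y z : X} {m : FreeMagma X}
    (h : SwapEquiv (FreeMagma.of x * (FreeMagma.of y * FreeMagma.of z)) m) :
    m = FreeMagma.of x * (FreeMagma.of y * FreeMagma.of z) ∨
    m = FreeMagma.of x * (FreeMagma.of z * FreeMagma.of y) ∨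
    m = (FreeMagma.of y * FreeMagma.of z) * FreeMagma.of x ∨
    m = (FreeMagma.of z * FreeMagma.of y) * FreeMagma.of x := by
  obtain ⟨a, b, ha, hb, h⟩ := h.mul_cases
  obtain ⟨c, d, hc, hd, h'⟩ := hb.mul_cases
  rw [ha.eq_of_of] at h
  rw [hc.eq_of_of, hd.eq_of_of] at h'
  rcases h with rfl | rfl <;> rcases h' with rfl | rfl <;> simp

theorem swapEquiv_triple_comm {x y z : X} {m : FreeMagma X} :
    SwapEquiv (FreeMagma.of x * (FreeMagma.of y * FreeMagma.of z)) m ↔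
      SwapEquiv (FreeMagma.of x * (FreeMagma.of z * FreeMagma.of y)) m := by
  have key : ∀ y z : X, SwapEquiv (FreeMagma.of x * (FreeMagma.of y * FreeMagma.of z)) m →
      SwapEquiv (FreeMagma.of x * (FreeMagma.of z * FreeMagma.of y)) m := by
    intro y z h
    rcases h.triple_cases with rfl | rfl | rfl | rfl
    · exact .same (.of _) (.swap (.of _) (.of _))
    · exact .same (.of _) (.same (.of _) (.of _))
    · exact .swap (.of _) (.swap (.of _) (.of _))
    · exact .swap (.of _) (.same (.of _) (.of _))
  exact ⟨key y z, key z y⟩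

/-- The suitable monomials are `[x, [y, z]]` on the word `xyz` if `x ≤ y`, and `[[y, z], x]` on
`yzx` if `y < x ≤ z`. For `x > z` the word `xyz` is not Lyndon–Shirshov, and `yzx` has the longer
Lyndon–Shirshov suffix `zx`, which forces the different bracketing `[y, [z, x]]`. -/
theorem exists_isLSMonomial_triple_iff {X : Type*} [LinearOrder X] {x y z : X} (hyz : y < z) :
    (∃ m, IsLSMonomial (fun x y : X => x < y) m ∧
      SwapEquiv (FreeMagma.of x * (FreeMagma.of y * FreeMagma.of z)) m) ↔ x ≤ z := by
  have : Std.Irrefl (fun x y : X => x < y) := ⟨fun a => lt_irrefl a⟩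
  constructor
  · rintro ⟨m, hm, h⟩
    rcases h.triple_cases with rfl | rfl | rfl | rfl
    · have := ((isLSWord_triple_iff _ x y z).1 hm.isLSWord).1
      cases this with
      | rel h => exact (h.trans hyz).le
      | cons h => exact hyz.le
    · exact absurd ((isLSWord_pair_iff _ z y).1 hm.right.isLSWord) hyz.not_gt
    · by_contra hx
      have := hm.suffix_le [y] [z, x] (by simp) rfl ((isLSWord_pair_iff _ z x).2 (not_le.1 hx))
      simp [leafWord] at this
    · exact absurd ((isLSWord_pair_iff _ z y).1 hm.left.isLSWord) hyz.not_gt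
  · intro hxz
    rcases le_or_gt x y with hxy | hxy
    · refine ⟨_, ?_, .same (.of _) (.same (.of _) (.of _))⟩
      refine .mul _ _ (.of x) (isLSMonomial_pair _ hyz) ?_ ?_
      · refine (isLSWord_triple_iff _ x y z).2 ⟨?_, .rel (hxy.trans_lt hyz)⟩
        rcases hxy.lt_or_eq with h | rfl
        · exact .rel h
        · exact .cons (.rel hyz)
      · intro u v hu e _
        have := congrArg List.length e
        have := List.length_pos_of_ne_nil hu
        simp [leafWord] at *
        omega
    · refine ⟨_, ?_, .swap (.of _) (.same (.of _) (.of _))⟩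
      refine .mul _ _ (isLSMonomial_pair _ hyz) (.of x) ?_ ?_
      · exact (isLSWord_triple_iff _ y z x).2 ⟨.rel hyz, .rel hxy⟩
      · rintro (_ | ⟨a, _ | ⟨b, u⟩⟩) v hu e hv
        · exact absurd rfl hu
        · simp only [leafWord, List.cons_append, List.nil_append, List.cons.injEq] at e
          obtain ⟨rfl, rfl⟩ := e
          exact absurd ((isLSWord_pair_iff _ z x).1 hv) hxz.not_gt
        · have := congrArg List.length e
          simp [leafWord] at *
          omega

end LyndonShirshov

/-! ### An explicit description of the admissible trees -/

section BlackRuns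

variable {X : Type*}

/-- The list is empty or its last dot is white. -/
def EndsWhite (a : List (Dot × X)) : Prop := ∀ e ∈ a.getLast?, e.1 = Dot.white

theorem AllBlack.cons {e : Dot × X} {u : List (Dot × X)} (he : e.1 = Dot.black)
    (hu : AllBlack u) : AllBlack (e :: u) := by
  intro f hf
  rcases List.mem_cons.1 hf with rfl | hf
  · exact he
  · exact hu f hf

theorem exists_finalBlackRun (d : List (Dot × X)) :
    ∃ a u, d = a ++ u ∧ AllBlack u ∧ EndsWhite a := by
  induction d using List.reverseRecOn with
  | nil => exact ⟨[], [], rfl, by simp [AllBlack], by simp [EndsWhite]⟩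
  | append_singleton d e ih =>
    obtain ⟨c, y⟩ := e
    cases c with
    | white => exact ⟨d ++ [(Dot.white, y)], [], by simp, by simp [AllBlack], by simp [EndsWhite]⟩
    | black =>
      obtain ⟨a, u, rfl, hu, ha⟩ := ih
      refine ⟨a, u ++ [(Dot.black, y)], by simp, ?_, ha⟩
      intro f hf
      rcases List.mem_append.1 hf with hf | hf
      · exact hu f hf
      · rw [List.mem_singleton.1 hf]

/-- If the two cuts differed, the dots between them would lie in one black run and also end the
other prefix, so the last of them would be both black and white. -/
theorem finalBlackRun_unique {a u a' u' : List (Dot × X)} (h : a ++ u = a' ++ u')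
    (hu : AllBlack u) (ha : EndsWhite a) (hu' : AllBlack u') (ha' : EndsWhite a') :
    a = a' ∧ u = u' := by
  have key : ∀ {a u c : List (Dot × X)}, AllBlack (c ++ u) → EndsWhite (a ++ c) → c = [] := by
    intro a u c h1 h2
    rcases List.eq_nil_or_concat c with rfl | ⟨c, e, rfl⟩
    · rfl
    · have := h1 e (by simp)
      rw [h2 e (by simp)] at this
      cases this
  rcases List.append_eq_append_iff.1 h with ⟨c, rfl, rfl⟩ | ⟨c, rfl, rfl⟩
  · obtain rfl := key hu ha'
    simp
  · obtain rfl := key hu' ha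
    simp

theorem EndsWhite.exists_run {a : List (Dot × X)} (h : EndsWhite a) (hne : a ≠ []) :
    ∃ u y b, a = u ++ (Dot.white, y) :: b ∧ AllBlack u := by
  induction a with
  | nil => exact absurd rfl hne
  | cons e a ih =>
    obtain ⟨c, x⟩ := e
    cases c with
    | white => exact ⟨[], x, a, rfl, by simp [AllBlack]⟩
    | black =>
      have hne' : a ≠ [] := by
        rintro rfl
        simp [EndsWhite] at h
      obtain ⟨u, y, b, rfl, hu⟩ := ih (by
        intro f hf
        refine h f ?_
        rw [List.getLast?_cons]
        simp only [Option.mem_def] at hf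
        simp [hf]) hne'
      exact ⟨(Dot.black, x) :: u, y, b, rfl, hu.cons rfl⟩

end BlackRuns

/-! ### Admissible trees as normal trees -/

section NormalTrees

variable {X : Type*} [LinearOrder X]

/-- Two neighbouring black dots carry weakly decreasing generators. -/
def RunRel (e f : Dot × X) : Prop := e.1 = Dot.black → f.1 = Dot.black → f.2 ≤ e.2

/-- Every run of black dots of the list is weakly decreasing. -/
abbrev RunSorted (d : List (Dot × X)) : Prop := d.IsChain RunRel

/-- The final black runs that occur in admissible trees; `p` selects the shape of the runs of
length two. -/
structure BlackCore (p : Prop) (u : List (Dot × X)) (z : X) : Prop where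
  ne_nil : u ≠ []
  allBlack : AllBlack u
  lastLT : LastLT u z
  head_le : p → u.length = 2 → ∀ e ∈ u.head?, e.2 ≤ z
  decreasing : ¬(p ∧ u.length = 2) → GensDecreasing u

/-- The admissible trees, sorted by the colour of the rightmost vertex. -/
inductive NormalTree (p : Prop) : DotTree X → Prop
  | gen (z : X) : NormalTree p ⟨[], z⟩
  | white (d : List (Dot × X)) (y z : X) : RunSorted d → y ≤ z →
      NormalTree p ⟨d ++ [(Dot.white, y)], z⟩
  | black (a u : List (Dot × X)) (z : X) : RunSorted a → EndsWhite a → BlackCore p u z →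
      NormalTree p ⟨a ++ u, z⟩

theorem AllBlack.runSorted_iff {u : List (Dot × X)} (hu : AllBlack u) :
    RunSorted u ↔ GensDecreasing u := by
  have : IsTrans (Dot × X) (fun e f : Dot × X => e.2 ≥ f.2) := ⟨fun a b c h h' => le_trans h' h⟩
  rw [GensDecreasing, ← List.isChain_iff_pairwise]
  induction u with
  | nil => simp
  | cons e u ih =>
    have ih := ih fun f hf => hu f (List.mem_cons_of_mem _ hf)
    unfold RunSorted at ih ⊢
    rw [List.isChain_cons, List.isChain_cons]
    refine and_congr (forall₂_congr fun f hf =>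
      ⟨fun h => h (hu e (by simp)) (hu f (List.mem_cons_of_mem _ (List.mem_of_mem_head? hf))),
        fun h _ _ => h⟩) ih

/-- Because `a` ends in white, two neighbouring black dots always belong to a run that is followed
by a white dot. -/
theorem runSorted_of_cond {a : List (Dot × X)} (ha : EndsWhite a)
    (h : ∀ (a' u b : List (Dot × X)) (y : X), a = a' ++ u ++ (Dot.white, y) :: b →
      AllBlack u → GensDecreasing u) : RunSorted a := by
  induction a with
  | nil => simp
  | cons e a ih =>
    rcases eq_or_ne a [] with rfl | hne
    · simp
    have ha' : EndsWhite a := by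
      intro f hf
      refine ha f ?_
      rw [List.getLast?_cons]
      simp only [Option.mem_def] at hf
      simp [hf]
    refine List.isChain_cons.2 ⟨?_, ih ha' fun a' u b y e' => h (e :: a') u b y (by simp [e'])⟩
    intro f hf he hfb
    obtain ⟨u, y, b, rfl, hu⟩ := ha'.exists_run hne
    have := h [] (e :: u) b y (by simp) (hu.cons he)
    cases u with
    | nil =>
      simp at hf
      subst hf
      cases hfb
    | cons g u =>
      simp at hf
      subst hf
      exact (List.pairwise_cons.1 this).1 _ (by simp)

/-- The hypotheses `h2` and `h3` contain all that is needed about Lyndon–Shirshov monomials: degree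
two imposes nothing beyond `y < z`, and degree three becomes one inequality chosen by `p`. -/
theorem mem_admissibleTrees_iff {r : X → X → Prop} {p : Prop}
    (h2 : ∀ y z : X, y < z →
      ∃ m, IsLSMonomial r m ∧ SwapEquiv (FreeMagma.of y * FreeMagma.of z) m)
    (h3 : ∀ x y z : X, y < z → ((∃ m, IsLSMonomial r m ∧
      SwapEquiv (FreeMagma.of x * (FreeMagma.of y * FreeMagma.of z)) m) ↔
        (p → x ≤ z) ∧ (¬p → y ≤ x))) (t : DotTree X) :
    t ∈ admissibleTrees r ↔ NormalTree p t := by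
  constructor
  · obtain ⟨d, z⟩ := t
    rintro ⟨c1, c2, c3, c4⟩
    obtain ⟨a, u, hd, hu, ha⟩ := exists_finalBlackRun d
    subst hd
    have hs : RunSorted a := runSorted_of_cond ha fun a' v b y e hv =>
      c1 a' v (b ++ u) y (by simp [e]) hv
    have hf : IsFinalBlackRun ⟨a ++ u, z⟩ u := ⟨a, rfl, hu, ha⟩
    rcases eq_or_ne u [] with rfl | hne
    · rcases List.eq_nil_or_concat a with rfl | ⟨a, ⟨c, y⟩, rfl⟩
      · exact .gen z
      · have hc : c = Dot.white := ha (c, y) (by simp)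
        subst hc
        simp only [List.concat_eq_append, List.append_nil] at *
        exact .white a y z (List.isChain_append.1 hs).1 (c2 a y rfl)
    · refine .black a u z hs ha ?_
      have hpos := List.length_pos_of_ne_nil hne
      rcases le_or_gt u.length 2 with hl | hl
      · obtain ⟨hlt, hm⟩ := c4 u hf hpos hl
        refine ⟨hne, hu, hlt, ?_, ?_⟩
        · intro hp hl2 e he
          match u, hl2 with
          | [e1, e2], _ =>
            simp at he
            subst he
            exact ((h3 e1.2 e2.2 z (hlt e2 (by simp))).1 hm).1 hp
        · intro hnp
          match u, hpos, hl with
          | [e1], _, _ => simp [GensDecreasing]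
          | [e1, e2], _, _ =>
            have := ((h3 e1.2 e2.2 z (hlt e2 (by simp))).1 hm).2 (fun hp => hnp ⟨hp, rfl⟩)
            simpa [GensDecreasing] using this
      · obtain ⟨hdec, hlt⟩ := c3 u hf hl
        exact ⟨hne, hu, hlt, fun _ h => by omega, fun _ => hdec⟩
  · intro h
    have cond1 : ∀ (a : List (Dot × X)), RunSorted a → ∀ (a' u b : List (Dot × X)) (y : X),
        a = a' ++ u ++ (Dot.white, y) :: b → AllBlack u → GensDecreasing u := by
      rintro _ ha a' u b y rfl hu
      rw [← hu.runSorted_iff]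
      exact (List.isChain_append.1 (List.isChain_append.1 ha).1).2.1
    cases h with
    | gen z =>
      refine ⟨?_, ?_, ?_, ?_⟩
      · intro a u b y e
        simp at e
      · intro a y e
        simp at e
      · rintro u ⟨a, e, -, -⟩ hl
        simp only [List.nil_eq, List.append_eq_nil_iff] at e
        simp [e.2] at hl
      · rintro u ⟨a, e, -, -⟩ hl
        simp only [List.nil_eq, List.append_eq_nil_iff] at e
        simp [e.2] at hl
    | white d y z hd hyz =>
      have hs : RunSorted (d ++ [(Dot.white, y)]) := by
        refine List.isChain_append.2 ⟨hd, by simp, ?_⟩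
        intro e _ f hf _ hfb
        simp at hf
        subst hf
        cases hfb
      have hnil : ∀ u, IsFinalBlackRun ⟨d ++ [(Dot.white, y)], z⟩ u → u = [] := by
        rintro u ⟨a, e, hu, ha⟩
        have := finalBlackRun_unique (a := d ++ [(Dot.white, y)]) (u := []) (by simpa using e)
          (by simp [AllBlack]) (by simp [EndsWhite]) hu ha
        exact this.2.symm
      refine ⟨cond1 _ hs, ?_, ?_, ?_⟩
      · intro a y' e
        have := List.append_inj_right' e (by simp)
        simp at this
        subst this
        exact hyz
      · intro u hu hl
        simp [hnil u hu] at hl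
      · intro u hu hl
        simp [hnil u hu] at hl
    | black a u z hs ha hc =>
      have huniq : ∀ v, IsFinalBlackRun ⟨a ++ u, z⟩ v → v = u := by
        rintro v ⟨a', e, hv, ha'⟩
        exact (finalBlackRun_unique e hc.allBlack ha hv ha').2.symm
      refine ⟨?_, ?_, ?_, ?_⟩
      · intro a' v b y e hv
        -- The white dot cannot lie in the final black run, so it lies in `a`; what follows it
        -- inside `a` is `c.tail`.
        rcases List.append_eq_append_iff.1 e with ⟨c, -, h⟩ | ⟨c, h, h'⟩
        · have := hc.allBlack (Dot.white, y) (by simp [h])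
          cases this
        · refine cond1 a hs a' v ?_ y ?_ hv
          · exact c.tail
          · rw [h]
            cases c with
            | nil =>
              have := hc.allBlack (Dot.white, y) (by
                simp only [List.nil_append] at h'
                simp [← h'])
              cases this
            | cons f c =>
              simp at h'
              simp [h'.1]
      · intro a' y e
        rcases List.eq_nil_or_concat u with hu | ⟨u', f, hu⟩
        · exact absurd hu hc.ne_nil
        · have hf := hc.allBlack f (by simp [hu])
          rw [hu] at e
          simp only [List.concat_eq_append, ← List.append_assoc] at e
          have := List.append_inj_right' e (by simp)
          simp at this
          subst this
          cases hf
      · intro v hv hl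
        obtain rfl := huniq v hv
        exact ⟨hc.decreasing (by omega), hc.lastLT⟩
      · intro v hv hpos hl
        obtain rfl := huniq v hv
        refine ⟨hc.lastLT, ?_⟩
        match v, hpos, hl with
        | [e1], _, _ => exact h2 e1.2 z (hc.lastLT e1 (by simp))
        | [e1, e2], _, _ =>
          refine (h3 e1.2 e2.2 z (hc.lastLT e2 (by simp))).2 ⟨?_, ?_⟩
          · intro hp
            exact hc.head_le hp rfl e1 (by simp)
          · intro hp
            have := hc.decreasing (by tauto)
            simpa [GensDecreasing] using this

theorem mem_admissibleTrees_lt_iff (t : DotTree X) :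
    t ∈ admissibleTrees (fun x y : X => x < y) ↔ NormalTree True t := by
  have : Std.Irrefl (fun x y : X => x < y) := ⟨fun a => lt_irrefl a⟩
  refine mem_admissibleTrees_iff (fun y z h => ?_) (fun x y z h => ?_) t
  · exact ⟨_, isLSMonomial_pair _ h, .same (.of _) (.of _)⟩
  · simpa using exists_isLSMonomial_triple_iff h

/-- The degree-three criterion is applied in `Xᵒᵈ` with `y` and `z` exchanged. It yields `y ≤ x`,
the same shape as for longer runs. -/
theorem mem_admissibleTrees_gt_iff (t : DotTree X) :
    t ∈ admissibleTrees (fun x y : X => x > y) ↔ NormalTree False t := by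
  have : Std.Irrefl (fun x y : X => x > y) := ⟨fun a => lt_irrefl a⟩
  refine mem_admissibleTrees_iff (fun y z h => ?_) (fun x y z h => ?_) t
  · exact ⟨_, isLSMonomial_pair _ h, .swap (.of _) (.of _)⟩
  · simp_rw [swapEquiv_triple_comm (y := y) (z := z)]
    have := exists_isLSMonomial_triple_iff (X := Xᵒᵈ) (x := x) (y := z) (z := y) h
    exact this.trans ⟨fun h => ⟨fun h => h.elim, fun _ => h⟩, fun h => h.2 id⟩

end NormalTrees

/-! ### A concrete metabelian Lie-admissible algebra -/

/-- The indices of the basis of the square of the model: a word of white operators, each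
preceded by a multiset of black operators, applied to a base element. -/
abbrev BaseIndex (X : Type*) := List (X × Multiset X) × Multiset X × (X ⊕ Sym2 X)

/-- The action of the operator of a dot on the basis of the square of the model. -/
def Dot.act {X : Type*} : Dot × X → BaseIndex X → BaseIndex X
  | (Dot.white, x), (l, s, g) => ((x, 0) :: l, s, g)
  | (Dot.black, x), ([], s, g) => ([], x ::ₘ s, g)
  | (Dot.black, x), ((y, t) :: l, s, g) => ((y, x ::ₘ t) :: l, s, g)

/-- The action of a list of dots on the basis of the square of the model. -/
def dotsAct {X : Type*} (d : List (Dot × X)) (n : BaseIndex X) : BaseIndex X := d.foldr Dot.act n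

/-- Black operators are stored in multisets; this commutation is what makes the Jacobi identity hold
in the model. -/
theorem Dot.act_black_comm {X : Type*} (x y : X) (n : BaseIndex X) :
    Dot.act (Dot.black, x) (Dot.act (Dot.black, y) n) =
      Dot.act (Dot.black, y) (Dot.act (Dot.black, x) n) := by
  obtain ⟨_ | ⟨⟨z, t⟩, l⟩, s, g⟩ := n <;> simp [Dot.act, Multiset.cons_swap x y]

/-- The underlying space of the model. -/
def Model (K X : Type*) [Field K] : Type _ := (X ⊕ BaseIndex X) →₀ K

namespace Model

variable {K X : Type*} [Field K]

noncomputable instance : AddCommGroup (Model K X) :=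
  inferInstanceAs (AddCommGroup ((X ⊕ BaseIndex X) →₀ K))

noncomputable instance : Module K (Model K X) :=
  inferInstanceAs (Module K ((X ⊕ BaseIndex X) →₀ K))

variable (K) in
/-- The basis vectors of the model. -/
noncomputable def vec (i : X ⊕ BaseIndex X) : Model K X := Finsupp.single i (1 : K)

variable (K) in
/-- The vector of the basis of the square. -/
noncomputable abbrev bvec (n : BaseIndex X) : Model K X := vec K (Sum.inr n)

@[elab_as_elim]
theorem induction {P : Model K X → Prop} (a : Model K X) (h0 : P 0)
    (hadd : ∀ a b, P a → P b → P (a + b)) (hvec : ∀ (k : K) i, P (k • vec K i)) : P a := by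
  refine Finsupp.induction_linear a h0 (fun f g => hadd f g) fun i k => ?_
  have : (Finsupp.single i k : (X ⊕ BaseIndex X) →₀ K) = k • Finsupp.single i (1 : K) := by
    simp
  rw [this]
  exact hvec k i

/-- The products of basis vectors. -/
noncomputable def table : X ⊕ BaseIndex X → X ⊕ BaseIndex X → Model K X
  -- Each product is half the sum of the prescribed anticommutator and commutator, so both come out
  -- without coefficients.
  | Sum.inl x, Sum.inl y => (2⁻¹ : K) • (bvec K ([], {x}, Sum.inl y) - bvec K ([], {y}, Sum.inl x)
      + bvec K ([], 0, Sum.inr s(x, y)))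
  | Sum.inl x, Sum.inr n =>
      (2⁻¹ : K) • (bvec K (Dot.act (Dot.white, x) n) + bvec K (Dot.act (Dot.black, x) n))
  | Sum.inr n, Sum.inl x =>
      (2⁻¹ : K) • (bvec K (Dot.act (Dot.white, x) n) - bvec K (Dot.act (Dot.black, x) n))
  | Sum.inr _, Sum.inr _ => 0

/-- The multiplication of the model as a bilinear map. -/
noncomputable def mulMap : Model K X →ₗ[K] Model K X →ₗ[K] Model K X :=
  Finsupp.linearCombination K fun i =>
    (Finsupp.linearCombination K (table i) : ((X ⊕ BaseIndex X) →₀ K) →ₗ[K] Model K X)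

noncomputable instance : Mul (Model K X) := ⟨fun a b => mulMap a b⟩

theorem mul_def (a b : Model K X) : a * b = mulMap a b := rfl

noncomputable instance : NonUnitalNonAssocRing (Model K X) where
  left_distrib a b c := by simp only [mul_def, map_add]
  right_distrib a b c := by simp only [mul_def, map_add, LinearMap.add_apply]
  zero_mul a := by simp only [mul_def, map_zero, LinearMap.zero_apply]
  mul_zero a := by simp only [mul_def, map_zero]

instance : IsScalarTower K (Model K X) (Model K X) where
  smul_assoc k a b := by simp only [smul_eq_mul, mul_def, map_smul, LinearMap.smul_apply]

instance : SMulCommClass K (Model K X) (Model K X) where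
  smul_comm k a b := by simp only [smul_eq_mul, mul_def, map_smul]

theorem vec_mul_vec (i j : X ⊕ BaseIndex X) : vec K i * vec K j = table i j := by
  have h1 : mulMap (vec K i) =
      (Finsupp.linearCombination K (table i) : ((X ⊕ BaseIndex X) →₀ K) →ₗ[K] Model K X) :=
    (Finsupp.linearCombination_single K (1 : K) i).trans (one_smul K _)
  rw [mul_def, h1]
  exact (Finsupp.linearCombination_single K (1 : K) j).trans (one_smul K _)

theorem polComm_bvec_bvec (m n : BaseIndex X) : polComm (bvec K m) (bvec K n) = 0 := by
  simp only [polComm, vec_mul_vec, table, sub_zero]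

variable [CharZero K]

/-- The Magnus-type formula `[x, y] = x e_y - y e_x`: the symmetric parts of the two products
cancel. -/
theorem polComm_gen_gen (x y : X) : polComm (vec K (Sum.inl x)) (vec K (Sum.inl y)) =
    bvec K ([], {x}, Sum.inl y) - bvec K ([], {y}, Sum.inl x) := by
  simp only [polComm, vec_mul_vec, table, Sym2.eq_swap (a := y) (b := x)]
  module

theorem polComm_gen_bvec (x : X) (n : BaseIndex X) :
    polComm (vec K (Sum.inl x)) (bvec K n) = bvec K (Dot.act (Dot.black, x) n) := by
  simp only [polComm, vec_mul_vec, table]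
  module

theorem polAnti_gen_gen (x y : X) : polAnti (vec K (Sum.inl x)) (vec K (Sum.inl y)) =
    bvec K ([], 0, Sum.inr s(x, y)) := by
  simp only [polAnti, vec_mul_vec, table, Sym2.eq_swap (a := y) (b := x)]
  module

theorem polAnti_gen_bvec (x : X) (n : BaseIndex X) :
    polAnti (vec K (Sum.inl x)) (bvec K n) = bvec K (Dot.act (Dot.white, x) n) := by
  simp only [polAnti, vec_mul_vec, table]
  module

end Model

/-! ### Calculus of commutators and of the Jacobian -/

section Commutators

variable {A : Type*} [NonUnitalNonAssocRing A]

theorem polComm_skew (a b : A) : polComm a b = -polComm b a := by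
  simp [polComm]

theorem polComm_sub_left (a b c : A) : polComm (a - b) c = polComm a c - polComm b c := by
  simp only [polComm, sub_mul, mul_sub]; abel

theorem polComm_sub_right (a b c : A) : polComm a (b - c) = polComm a b - polComm a c := by
  simp only [polComm, sub_mul, mul_sub]; abel

theorem polComm_neg_left (a b : A) : polComm (-a) b = -polComm a b := by
  simp only [polComm, neg_mul, mul_neg]; abel

theorem polComm_neg_right (a b : A) : polComm a (-b) = -polComm a b := by
  simp only [polComm, neg_mul, mul_neg]; abel

theorem polComm_zero_left (a : A) : polComm 0 a = 0 := by
  simp [polComm]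

theorem polAnti_sub_right (a b c : A) : polAnti a (b - c) = polAnti a b - polAnti a c := by
  simp only [polAnti, sub_mul, mul_sub]; abel

theorem polAnti_comm (a b : A) : polAnti a b = polAnti b a := by
  simp only [polAnti]; abel

theorem lieAdmissibleExpr_eq (a b c : A) : lieAdmissibleExpr a b c =
    polComm (polComm a b) c + polComm (polComm b c) a + polComm (polComm c a) b := by
  simp only [lieAdmissibleExpr, polComm, sub_mul, mul_sub]; abel

theorem lieAdmissibleExpr_rotate (a b c : A) :
    lieAdmissibleExpr a b c = lieAdmissibleExpr b c a := by
  simp only [lieAdmissibleExpr]; abel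

theorem lieAdmissibleExpr_add (a a' b c : A) :
    lieAdmissibleExpr (a + a') b c = lieAdmissibleExpr a b c + lieAdmissibleExpr a' b c := by
  simp only [lieAdmissibleExpr, add_mul, mul_add]; abel

theorem lieAdmissibleExpr_zero (b c : A) : lieAdmissibleExpr 0 b c = 0 := by
  simp [lieAdmissibleExpr]

theorem lieAdmissibleExpr_smul {K : Type*} [Field K] [Module K A] [IsScalarTower K A A]
    [SMulCommClass K A A] (k : K) (a b c : A) :
    lieAdmissibleExpr (k • a) b c = k • lieAdmissibleExpr a b c := by
  simp only [lieAdmissibleExpr, smul_mul_assoc, mul_smul_comm, smul_add, smul_sub]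

end Commutators

/-! ### The identities of the model and the images of monomials -/

namespace Model

variable {K X : Type*} [Field K]

theorem lieAdmissibleExpr_vec_left {b c : Model K X}
    (h : ∀ i, lieAdmissibleExpr (vec K i) b c = 0) (a : Model K X) :
    lieAdmissibleExpr a b c = 0 := by
  induction a using Model.induction with
  | h0 => exact lieAdmissibleExpr_zero b c
  | hadd a a' ha ha' => rw [lieAdmissibleExpr_add, ha, ha', add_zero]
  | hvec k i => rw [lieAdmissibleExpr_smul, h, smul_zero]

variable (K X) in
/-- The span of the part of the basis of the model outside the generators. -/
noncomputable def square : Submodule K (Model K X) := Submodule.span K (Set.range (bvec K))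

theorem mul_mem_square (a b : Model K X) : a * b ∈ square K X := by
  have hb : ∀ n, bvec K n ∈ square K X := fun n => Submodule.subset_span ⟨n, rfl⟩
  induction a using Model.induction with
  | h0 => rw [zero_mul]; exact Submodule.zero_mem _
  | hadd a a' ha ha' => rw [add_mul]; exact Submodule.add_mem _ ha ha'
  | hvec k i =>
    rw [smul_mul_assoc]
    refine Submodule.smul_mem _ _ ?_
    induction b using Model.induction with
    | h0 => rw [mul_zero]; exact Submodule.zero_mem _
    | hadd a a' ha ha' => rw [mul_add]; exact Submodule.add_mem _ ha ha'
    | hvec k j =>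
      rw [mul_smul_comm, vec_mul_vec]
      refine Submodule.smul_mem _ _ ?_
      rcases i with x | m <;> rcases j with y | n <;> simp only [table]
      · exact Submodule.smul_mem _ _ (Submodule.add_mem _ (Submodule.sub_mem _ (hb _) (hb _)) (hb _))
      · exact Submodule.smul_mem _ _ (Submodule.add_mem _ (hb _) (hb _))
      · exact Submodule.smul_mem _ _ (Submodule.sub_mem _ (hb _) (hb _))
      · exact Submodule.zero_mem _

theorem mul_eq_zero_of_mem_square {a b : Model K X} (ha : a ∈ square K X)
    (hb : b ∈ square K X) : a * b = 0 := by
  induction ha using Submodule.span_induction with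
  | zero => exact zero_mul b
  | add x y _ _ hx hy => rw [add_mul, hx, hy, add_zero]
  | smul k x _ hx => rw [smul_mul_assoc, hx, smul_zero]
  | mem x hx =>
    obtain ⟨m, rfl⟩ := hx
    induction hb using Submodule.span_induction with
    | zero => exact mul_zero _
    | add x y _ _ hx hy => rw [mul_add, hx, hy, add_zero]
    | smul k x _ hx => rw [mul_smul_comm, hx, smul_zero]
    | mem x hx =>
      obtain ⟨n, rfl⟩ := hx
      exact vec_mul_vec _ _

theorem metabelian (a b c d : Model K X) : metabelianExpr a b c d = 0 :=
  mul_eq_zero_of_mem_square (mul_mem_square a b) (mul_mem_square c d)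

variable (K X) in
/-- The homomorphism of the free nonassociative algebra to the model. -/
noncomputable def freeHom : FreeNonUnitalNonAssocAlgebra K X →ₙₐ[K] Model K X :=
  FreeNonUnitalNonAssocAlgebra.lift K fun x => vec K (Sum.inl x)

variable [CharZero K]

/-- Of three basis vectors two are of the same kind, and a cyclic rotation moves them to the front.
With two generators in front the terms cancel because black operators commute; with two elements of
the square in front every term vanishes. -/
theorem lieAdmissibleExpr_vec (i j k : X ⊕ BaseIndex X) :
    lieAdmissibleExpr (vec K i) (vec K j) (vec K k) = 0 := by
  have gb : ∀ (n : BaseIndex X) (x : X), polComm (bvec K n) (vec K (Sum.inl x)) =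
      -bvec K (Dot.act (Dot.black, x) n) := fun n x => by
    rw [polComm_skew, polComm_gen_bvec]
  have base : ∀ (x y : X) (k), lieAdmissibleExpr (vec K (Sum.inl x)) (vec K (Sum.inl y))
      (vec K k) = 0 := by
    rintro x y (z | n)
    · simp only [lieAdmissibleExpr_eq, polComm_gen_gen, polComm_sub_left, gb, Dot.act]
      simp only [← Multiset.singleton_add, add_comm ({y} : Multiset X) {x},
        add_comm ({z} : Multiset X) {x}, add_comm ({z} : Multiset X) {y}]
      abel
    · simp only [lieAdmissibleExpr_eq, polComm_gen_gen, polComm_sub_left, gb, polComm_bvec_bvec,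
        polComm_gen_bvec, polComm_neg_left, Dot.act_black_comm y x]
      abel
  have two : ∀ (m n : BaseIndex X) (k), lieAdmissibleExpr (bvec K m) (bvec K n)
      (vec K k) = 0 := by
    rintro m n (z | k)
    · simp only [lieAdmissibleExpr_eq, gb, polComm_gen_bvec, polComm_bvec_bvec, polComm_neg_left,
        polComm_zero_left]
      simp
    · simp only [lieAdmissibleExpr_eq, polComm_bvec_bvec, polComm_zero_left]
      simp
  rcases i with x | m <;> rcases j with y | n <;> rcases k with z | l
  · exact base x y _
  · exact base x y _
  · rw [lieAdmissibleExpr_rotate, lieAdmissibleExpr_rotate]; exact base z x _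
  · rw [lieAdmissibleExpr_rotate]; exact two n l _
  · rw [lieAdmissibleExpr_rotate]; exact base y z _
  · rw [lieAdmissibleExpr_rotate, lieAdmissibleExpr_rotate]; exact two l m _
  · exact two m n _
  · exact two m n _

theorem lieAdmissible (a b c : Model K X) : lieAdmissibleExpr a b c = 0 := by
  refine lieAdmissibleExpr_vec_left (fun i => ?_) a
  rw [lieAdmissibleExpr_rotate]
  refine lieAdmissibleExpr_vec_left (fun j => ?_) b
  rw [lieAdmissibleExpr_rotate]
  refine lieAdmissibleExpr_vec_left (fun k => ?_) c
  rw [lieAdmissibleExpr_rotate]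
  exact lieAdmissibleExpr_vec i j k

theorem mLieAdmIdeal_le_ker :
    mLieAdmIdeal K X ≤ LinearMap.ker (freeHom K X : _ →ₗ[K] Model K X) := by
  refine sInf_le ⟨?_, ?_⟩
  · rintro z (⟨a, b, c, rfl⟩ | ⟨a, b, c, d, rfl⟩)
    · have := lieAdmissible (freeHom K X a) (freeHom K X b) (freeHom K X c)
      simpa [lieAdmissibleExpr] using this
    · have := metabelian (freeHom K X a) (freeHom K X b) (freeHom K X c) (freeHom K X d)
      simpa [metabelianExpr] using this
  · intro a x hx
    have hx : freeHom K X x = 0 := hx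
    constructor
    · change freeHom K X (a * x) = 0
      rw [map_mul, hx, mul_zero]
    · change freeHom K X (x * a) = 0
      rw [map_mul, hx, zero_mul]

variable (K X) in
/-- The map of the free metabelian Lie-admissible algebra to the model. -/
noncomputable def hom : FreeMLieAdm K X →ₗ[K] Model K X :=
  (mLieAdmIdeal K X).liftQ (freeHom K X : _ →ₗ[K] Model K X) mLieAdmIdeal_le_ker

theorem hom_mk (a : FreeNonUnitalNonAssocAlgebra K X) :
    hom K X (FreeMLieAdm.mk K a) = freeHom K X a := rfl

theorem hom_mul (a b : FreeMLieAdm K X) : hom K X (a * b) = hom K X a * hom K X b := by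
  obtain ⟨a, rfl⟩ := FreeMLieAdm.mk_surjective a
  obtain ⟨b, rfl⟩ := FreeMLieAdm.mk_surjective b
  rw [← FreeMLieAdm.mk_mul, hom_mk, hom_mk, hom_mk, map_mul]

theorem hom_gen (x : X) : hom K X (FreeMLieAdm.gen K x) = vec K (Sum.inl x) := by
  rw [FreeMLieAdm.gen, hom_mk, freeHom, FreeNonUnitalNonAssocAlgebra.lift_of_apply]

theorem hom_op (c : Dot) (a b : FreeMLieAdm K X) :
    hom K X (c.op a b) = c.op (hom K X a) (hom K X b) := by
  cases c <;> simp only [Dot.op, polComm, polAnti, map_sub, map_add, hom_mul]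

theorem op_gen_bvec (e : Dot × X) (n : BaseIndex X) :
    e.1.op (vec K (Sum.inl e.2)) (bvec K n) = bvec K (Dot.act e n) := by
  obtain ⟨_ | _, x⟩ := e
  · exact polComm_gen_bvec x n
  · exact polAnti_gen_bvec x n

theorem hom_monomial_white (d : List (Dot × X)) (y z : X) :
    hom K X (DotTree.monomial K ⟨d ++ [(Dot.white, y)], z⟩) =
      bvec K (dotsAct d ([], 0, Sum.inr s(y, z))) := by
  induction d with
  | nil =>
    simp only [DotTree.monomial, List.nil_append, List.foldr_cons, List.foldr_nil, hom_op, hom_gen]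
    exact polAnti_gen_gen y z
  | cons e d ih =>
    have : DotTree.monomial K ⟨(e :: d) ++ [(Dot.white, y)], z⟩ =
      e.1.op (FreeMLieAdm.gen K e.2) (DotTree.monomial K ⟨d ++ [(Dot.white, y)], z⟩) := rfl
    rw [this, hom_op, ih, hom_gen, op_gen_bvec]
    rfl

/-- The last bracket gives `y e_z - z e_y`, and every further operator sends basis vectors to basis
vectors. -/
theorem hom_monomial_black (d : List (Dot × X)) (y z : X) :
    hom K X (DotTree.monomial K ⟨d ++ [(Dot.black, y)], z⟩) =
      bvec K (dotsAct d ([], {y}, Sum.inl z)) - bvec K (dotsAct d ([], {z}, Sum.inl y)) := by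
  induction d with
  | nil =>
    simp only [DotTree.monomial, List.nil_append, List.foldr_cons, List.foldr_nil, hom_op, hom_gen]
    exact polComm_gen_gen y z
  | cons e d ih =>
    have : DotTree.monomial K ⟨(e :: d) ++ [(Dot.black, y)], z⟩ =
      e.1.op (FreeMLieAdm.gen K e.2) (DotTree.monomial K ⟨d ++ [(Dot.black, y)], z⟩) := rfl
    have hsub : ∀ (c : Dot) (u v w : Model K X), c.op u (v - w) = c.op u v - c.op u w := by
      rintro (_ | _) u v w
      · exact polComm_sub_right u v w
      · exact polAnti_sub_right u v w
    rw [this, hom_op, ih, hom_gen, hsub, op_gen_bvec, op_gen_bvec]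
    rfl

end Model

/-! ### Recovering a sorted list of dots from its action -/

section Decode

variable {X : Type*}

theorem dotsAct_append (d d' : List (Dot × X)) (n : BaseIndex X) :
    dotsAct (d ++ d') n = dotsAct d (dotsAct d' n) := List.foldr_append

theorem dotsAct_snd_snd (d : List (Dot × X)) (n : BaseIndex X) : (dotsAct d n).2.2 = n.2.2 := by
  induction d with
  | nil => rfl
  | cons e d ih =>
    rw [← ih]
    change (Dot.act e (dotsAct d n)).2.2 = _
    obtain ⟨_ | _, x⟩ := e <;> obtain ⟨_ | _, s, g⟩ := dotsAct d n <;> rfl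

theorem AllBlack.dotsAct {u : List (Dot × X)} (hu : AllBlack u) (s : Multiset X)
    (g : X ⊕ Sym2 X) : dotsAct u ([], s, g) = ([], (u.map Prod.snd : Multiset X) + s, g) := by
  induction u with
  | nil => simp [_root_.dotsAct]
  | cons e u ih =>
    change Dot.act e (_root_.dotsAct u _) = _
    rw [ih fun f hf => hu f (List.mem_cons_of_mem _ hf)]
    have he := hu e (by simp)
    obtain ⟨c, x⟩ := e
    simp only at he
    subst he
    simp [Dot.act, ← Multiset.cons_coe]

/-- Once a white operator is present, later dots change only the list of white operators and the
multisets attached to it, so the multiset of the final run is frozen. -/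
theorem dotsAct_snd_fst_of_ne_nil (d : List (Dot × X)) {n : BaseIndex X} (hn : n.1 ≠ []) :
    (dotsAct d n).1 ≠ [] ∧ (dotsAct d n).2.1 = n.2.1 := by
  induction d with
  | nil => exact ⟨hn, rfl⟩
  | cons e d ih =>
    change (Dot.act e (dotsAct d n)).1 ≠ [] ∧ (Dot.act e (dotsAct d n)).2.1 = _
    rw [← ih.2]
    obtain ⟨c, x⟩ := e
    generalize dotsAct d n = m at ih
    obtain ⟨_ | ⟨f, l⟩, s, g⟩ := m
    · exact absurd rfl ih.1
    · cases c <;> exact ⟨List.cons_ne_nil _ _, rfl⟩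

theorem EndsWhite.dotsAct_snd_fst {a : List (Dot × X)} (ha : EndsWhite a) (n : BaseIndex X) :
    (dotsAct a n).2.1 = n.2.1 := by
  rcases List.eq_nil_or_concat a with rfl | ⟨a, ⟨c, y⟩, rfl⟩
  · rfl
  · have hc : c = Dot.white := ha (c, y) (by simp)
    subst hc
    rw [List.concat_eq_append, dotsAct_append]
    exact (dotsAct_snd_fst_of_ne_nil a (n := dotsAct [(Dot.white, y)] n)
      (List.cons_ne_nil _ _)).2

variable [LinearOrder X]

/-- The sorted list of black dots of a multiset. -/
noncomputable def blackDots (s : Multiset X) : List (Dot × X) :=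
  (s.sort (· ≥ ·)).map fun x => (Dot.black, x)

theorem blackDots_cons {x : X} {s : Multiset X} (h : ∀ y ∈ s, y ≤ x) :
    blackDots (x ::ₘ s) = (Dot.black, x) :: blackDots s := by
  rw [blackDots, Multiset.sort_cons _ _ _ h]
  rfl

theorem forall_le_of_head_blackDots {x : X} {s : Multiset X} {t : List (Dot × X)}
    (h : ∀ f ∈ (blackDots s ++ t).head?, RunRel (Dot.black, x) f) : ∀ y ∈ s, y ≤ x := by
  intro y hy
  rw [← Multiset.mem_sort (r := (· ≥ ·))] at hy
  have hs := Multiset.pairwise_sort s (· ≥ ·)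
  rw [blackDots] at h
  generalize s.sort (· ≥ ·) = l at *
  cases l with
  | nil => simp at hy
  | cons w l =>
    have hw : w ≤ x := h (Dot.black, w) (by simp) rfl rfl
    rcases List.mem_cons.1 hy with rfl | hy
    · exact hw
    · exact ((List.pairwise_cons.1 hs).1 y hy).trans hw

/-- The sorted list of dots of a basis index. -/
noncomputable def indexDots (n : BaseIndex X) : List (Dot × X) :=
  (n.1.flatMap fun e => blackDots e.2 ++ [(Dot.white, e.1)]) ++ blackDots n.2.1

/-- Sorting each multiset undoes the action: in a sorted list of dots a new black generator
dominates the run that it joins, so it comes first again after sorting. -/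
theorem indexDots_dotsAct {d : List (Dot × X)} (hd : RunSorted d) (g : X ⊕ Sym2 X) :
    indexDots (dotsAct d ([], 0, g)) = d := by
  induction d with
  | nil => simp [dotsAct, indexDots, blackDots]
  | cons e d ih =>
    obtain ⟨hhead, hd⟩ := List.isChain_cons.1 hd
    have ih := ih hd
    change indexDots (Dot.act e (dotsAct d ([], 0, g))) = _
    generalize dotsAct d ([], 0, g) = n at *
    subst ih
    obtain ⟨_ | _, x⟩ := e
    · obtain ⟨_ | ⟨⟨w, t⟩, l⟩, s, g⟩ := n
      · simp only [indexDots, Dot.act, List.flatMap_nil, List.nil_append] at hhead ⊢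
        exact blackDots_cons (forall_le_of_head_blackDots (t := []) (by simpa using hhead))
      · simp only [indexDots, Dot.act, List.flatMap_cons, List.append_assoc] at hhead ⊢
        rw [blackDots_cons (forall_le_of_head_blackDots hhead)]
        rfl
    · simp [indexDots, Dot.act, blackDots]

theorem dotsAct_injective {d d' : List (Dot × X)} (hd : RunSorted d) (hd' : RunSorted d')
    {g g' : X ⊕ Sym2 X} (h : dotsAct d ([], 0, g) = dotsAct d' ([], 0, g')) :
    d = d' ∧ g = g' := by
  refine ⟨?_, ?_⟩
  · rw [← indexDots_dotsAct hd g, h, indexDots_dotsAct hd' g']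
  · simpa only [dotsAct_snd_snd] using congrArg (fun n => n.2.2) h

end Decode

/-! ### Linear independence -/

section Independence

variable {K X : Type*} [Field K]

theorem allBlack_pair (x y : X) : AllBlack [(Dot.black, x), (Dot.black, y)] := by
  simp [AllBlack]

theorem dotsAct_run {a u : List (Dot × X)} (ha : EndsWhite a) (hu : AllBlack u) (s : Multiset X)
    (g : X ⊕ Sym2 X) :
    (dotsAct (a ++ u) ([], s, g)).2 = ((u.map Prod.snd : Multiset X) + s, g) := by
  refine Prod.ext ?_ ?_
  · rw [dotsAct_append, ha.dotsAct_snd_fst, hu.dotsAct]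
  · rw [dotsAct_snd_snd]

theorem dotsAct_singleton (d : List (Dot × X)) (y : X) (g : X ⊕ Sym2 X) :
    dotsAct d ([], {y}, g) = dotsAct (d ++ [(Dot.black, y)]) ([], 0, g) := by
  rw [dotsAct_append]
  rfl

variable [LinearOrder X]

theorem EndsWhite.runSorted_append {a u : List (Dot × X)} (ha : EndsWhite a)
    (hs : RunSorted a) (hu : RunSorted u) : RunSorted (a ++ u) := by
  refine List.isChain_append.2 ⟨hs, hu, fun e he f _ heb _ => ?_⟩
  rw [ha e he] at heb
  cases heb

/-- The basis vectors of the model that may occur as leading terms of admissible trees. -/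
def Kept (p : Prop) : X ⊕ BaseIndex X → Prop
  | Sum.inl _ => True
  | Sum.inr (_, _, Sum.inr _) => True
  | Sum.inr (_, s, Sum.inl z) =>
    (p ∧ s.card = 2 → ∃ y ∈ s, z < y) ∧ (¬(p ∧ s.card = 2) → ∃ y ∈ s, y < z)

open Classical in
variable (K) in
/-- The projection of the model to the span of the leading terms. -/
noncomputable def keptProj (p : Prop) : Model K X →ₗ[K] Model K X :=
  Finsupp.linearCombination K fun i => if Kept p i then Model.vec K i else 0

theorem keptProj_vec {p : Prop} {i : X ⊕ BaseIndex X} (h : Kept p i) :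
    keptProj K p (Model.vec K i) = Model.vec K i := by
  refine (Finsupp.linearCombination_single K (1 : K) i).trans ?_
  rw [if_pos h, one_smul]

theorem keptProj_vec_eq_zero {p : Prop} {i : X ⊕ BaseIndex X} (h : ¬Kept p i) :
    keptProj K p (Model.vec K i) = 0 := by
  refine (Finsupp.linearCombination_single K (1 : K) i).trans ?_
  rw [if_neg h, smul_zero]

/-- The leading term of an admissible tree. -/
inductive LeadingTerm (p : Prop) : DotTree X → X ⊕ BaseIndex X → Prop
  | gen (z : X) : LeadingTerm p ⟨[], z⟩ (Sum.inl z)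
  | white (d : List (Dot × X)) (y z : X) : RunSorted d → y ≤ z →
      LeadingTerm p ⟨d ++ [(Dot.white, y)], z⟩ (Sum.inr (dotsAct d ([], 0, Sum.inr s(y, z))))
  | black (a u : List (Dot × X)) (z : X) : RunSorted (a ++ u) → EndsWhite a → AllBlack u →
      ¬(p ∧ u.length = 2) →
      LeadingTerm p ⟨a ++ u, z⟩ (Sum.inr (dotsAct (a ++ u) ([], 0, Sum.inl z)))
  | alt (a : List (Dot × X)) (x y z : X) : RunSorted (a ++ [(Dot.black, z), (Dot.black, x)]) →
      EndsWhite a → p → LeadingTerm p ⟨a ++ [(Dot.black, x), (Dot.black, y)], z⟩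
        (Sum.inr (dotsAct (a ++ [(Dot.black, z), (Dot.black, x)]) ([], 0, Sum.inl y)))

/-- The base element separates white from black endings, and the length of the final run separates
`black` from `alt`. Within a kind the sorted dots are decoded from the index; for `white`, the
inequality `y ≤ z` orders the unordered pair. -/
theorem LeadingTerm.injective {p : Prop} {t t' : DotTree X} {i i' : X ⊕ BaseIndex X}
    (h : LeadingTerm p t i) (h' : LeadingTerm p t' i') (hi : i = i') : t = t' := by
  have white_ne : ∀ (d d' : List (Dot × X)) (q : Sym2 X) (z : X),
      dotsAct d ([], 0, Sum.inr q) ≠ dotsAct d' ([], 0, Sum.inl z) := by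
    intro d d' q z e
    have := congrArg (fun n => n.2.2) e
    simp [dotsAct_snd_snd] at this
  have alt_ne : ∀ (a u : List (Dot × X)) (z : X) (b : List (Dot × X)) (x y w : X), p →
      RunSorted (a ++ u) → EndsWhite a → AllBlack u → ¬(p ∧ u.length = 2) →
      RunSorted (b ++ [(Dot.black, w), (Dot.black, x)]) → EndsWhite b →
      dotsAct (a ++ u) ([], 0, Sum.inl z) ≠
        dotsAct (b ++ [(Dot.black, w), (Dot.black, x)]) ([], 0, Sum.inl y) := by
    intro a u z b x y w hp hs ha hu hn hs' hb e
    obtain ⟨e, -⟩ := dotsAct_injective hs hs' e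
    obtain ⟨-, rfl⟩ := finalBlackRun_unique e hu ha (allBlack_pair _ _) hb
    exact hn ⟨hp, rfl⟩
  cases h with
  | gen z => cases h' <;> simp_all
  | white d y z hd hyz =>
    cases h' with
    | gen => simp at hi
    | white d' y' z' hd' hyz' =>
      obtain ⟨rfl, hq⟩ := dotsAct_injective hd hd' (Sum.inr.inj hi)
      rcases Sym2.eq_iff.1 (Sum.inr.inj hq) with ⟨rfl, rfl⟩ | ⟨rfl, rfl⟩
      · rfl
      · rw [le_antisymm hyz hyz']
    | black => exact absurd (Sum.inr.inj hi) (white_ne _ _ _ _)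
    | alt => exact absurd (Sum.inr.inj hi) (white_ne _ _ _ _)
  | black a u z hs ha hu hn =>
    cases h' with
    | gen => simp at hi
    | white => exact absurd (Sum.inr.inj hi).symm (white_ne _ _ _ _)
    | black a' u' z' hs' ha' hu' hn' =>
      obtain ⟨e, hz⟩ := dotsAct_injective hs hs' (Sum.inr.inj hi)
      rw [e, Sum.inl.inj hz]
    | alt b x y w hs' hb hp =>
      exact absurd (Sum.inr.inj hi) (alt_ne _ _ _ _ _ _ _ hp hs ha hu hn hs' hb)
  | alt b x y w hs hb hp =>
    cases h' with
    | gen => simp at hi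
    | white => exact absurd (Sum.inr.inj hi).symm (white_ne _ _ _ _)
    | black a u z hs' ha' hu hn =>
      exact absurd (Sum.inr.inj hi).symm (alt_ne _ _ _ _ _ _ _ hp hs' ha' hu hn hs hb)
    | alt b' x' y' w' hs' hb' hp' =>
      obtain ⟨e, hz⟩ := dotsAct_injective hs hs' (Sum.inr.inj hi)
      obtain ⟨rfl, e⟩ := finalBlackRun_unique e (allBlack_pair _ _) hb (allBlack_pair _ _) hb'
      simp at e
      rw [e.1, e.2, Sum.inl.inj hz]

/-- The final multiset consists of the generators of `u` and the extra `x`, so cardinality two means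
`u.length = 1`. -/
theorem kept_run_iff {p : Prop} {a u : List (Dot × X)} (ha : EndsWhite a) (hu : AllBlack u)
    (x z : X) : Kept p (Sum.inr (dotsAct (a ++ u) ([], {x}, Sum.inl z))) ↔
      (p ∧ u.length = 1 → ∃ y ∈ x :: u.map Prod.snd, z < y) ∧
      (¬(p ∧ u.length = 1) → ∃ y ∈ x :: u.map Prod.snd, y < z) := by
  have h := dotsAct_run ha hu {x} (Sum.inl z)
  generalize dotsAct (a ++ u) ([], {x}, Sum.inl z) = n at h
  obtain ⟨l, s, g⟩ := n
  obtain ⟨rfl, rfl⟩ := Prod.mk.inj h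
  have hmem : ∀ y, y ∈ ((u.map Prod.snd : Multiset X) + {x}) ↔ y ∈ x :: u.map Prod.snd := by
    intro y
    rw [Multiset.mem_add, Multiset.mem_coe, Multiset.mem_singleton, List.mem_cons, or_comm]
  simp only [Kept, hmem]
  simp

variable [CharZero K]

/-- For a black ending the image is a difference of terms with bases `e_z` and `e_y`, where `y < z`.
Ordinarily `y` is minimal in its run, and the `e_z` term survives since it has an operator below
`z`. In the exceptional runs of length two `z` is maximal, and the `e_y` term survives since it has
an operator above `y`. -/
theorem exists_leadingTerm {p : Prop} {t : DotTree X} (ht : NormalTree p t) :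
    ∃ i, LeadingTerm p t i ∧ ∃ c : Kˣ,
      keptProj K p (Model.hom K X (t.monomial K)) = c • Model.vec K i := by
  cases ht with
  | gen z =>
    refine ⟨_, .gen z, 1, ?_⟩
    rw [one_smul]
    exact (congrArg _ (Model.hom_gen z)).trans (keptProj_vec trivial)
  | white d y z hd hyz =>
    refine ⟨_, .white d y z hd hyz, 1, ?_⟩
    rw [one_smul, Model.hom_monomial_white, keptProj_vec]
    have h := dotsAct_snd_snd d ([], 0, Sum.inr s(y, z))
    generalize dotsAct d ([], 0, Sum.inr s(y, z)) = n at h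
    obtain ⟨l, s, g⟩ := n
    simp only at h
    subst h
    trivial
  | black a u z hs ha hc =>
    obtain ⟨v, ⟨c, y⟩, rfl⟩ := (List.eq_nil_or_concat u).resolve_left hc.ne_nil
    rw [List.concat_eq_append] at hc ⊢
    have hcb : c = Dot.black := hc.allBlack (c, y) (by simp)
    subst hcb
    have hv : AllBlack v := fun e he => hc.allBlack e (by simp [he])
    have hyz : y < z := hc.lastLT (Dot.black, y) (by simp)
    by_cases hp : p ∧ v.length = 1
    · match v, hp with
      | [(c, x)], hp =>
        have hcb : c = Dot.black := hv (c, x) (by simp)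
        subst hcb
        have hxz : x ≤ z := hc.head_le hp.1 rfl (Dot.black, x) (by simp)
        have hpair : RunSorted [(Dot.black, z), (Dot.black, x)] := by
          rw [(allBlack_pair _ _).runSorted_iff]
          simpa [GensDecreasing] using hxz
        -- The second term of the difference survives, hence the unit `-1`. Its operators `x, z` are
        -- listed as `z, x`, which is sorted because `x ≤ z`.
        refine ⟨_, .alt a x y z (ha.runSorted_append hs hpair) ha hp.1, -1, ?_⟩
        rw [List.singleton_append]
        have := Model.hom_monomial_black (K := K) (a ++ [(Dot.black, x)]) y z
        simp only [List.append_assoc, List.singleton_append] at this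
        rw [this, map_sub, keptProj_vec_eq_zero, keptProj_vec, zero_sub, Units.neg_smul, one_smul]
        · congr 3
          rw [dotsAct_append, dotsAct_append]
          congr 1
          simp only [dotsAct, Dot.act, List.foldr_cons, List.foldr_nil]
          exact congrArg (fun s => (([], s, Sum.inl y) : BaseIndex X)) (Multiset.cons_swap x z 0)
        · rw [kept_run_iff ha hv]
          exact ⟨fun _ => ⟨z, by simp, hyz⟩, fun h => absurd hp h⟩
        · rw [kept_run_iff ha hv]
          rintro ⟨h, -⟩
          obtain ⟨w, hw, hzw⟩ := h hp
          simp only [List.map_cons, List.map_nil, List.mem_cons, List.not_mem_nil, or_false] at hw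
          rcases hw with rfl | rfl
          · exact hyz.not_gt hzw
          · exact hxz.not_gt hzw
    · have hn : ¬(p ∧ (v ++ [(Dot.black, y)]).length = 2) := by simpa using hp
      have hdec := hc.decreasing hn
      refine ⟨_, .black a (v ++ [(Dot.black, y)]) z
        (ha.runSorted_append hs (hc.allBlack.runSorted_iff.2 hdec)) ha hc.allBlack hn, 1, ?_⟩
      rw [← List.append_assoc, one_smul, Model.hom_monomial_black, map_sub, keptProj_vec,
        keptProj_vec_eq_zero, sub_zero, dotsAct_singleton]
      · rw [kept_run_iff ha hv]
        -- In the `e_y` term all operators come from `v` or equal `z`, and none of them is below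
        -- `y`.
        rintro ⟨-, h⟩
        obtain ⟨w, hw, hwy⟩ := h hp
        rcases List.mem_cons.1 hw with rfl | hw
        · exact hyz.not_gt hwy
        · obtain ⟨e, he, rfl⟩ := List.mem_map.1 hw
          exact ((List.pairwise_append.1 hdec).2.2 e he (Dot.black, y) (by simp)).not_gt hwy
      · rw [kept_run_iff ha hv]
        exact ⟨fun h => absurd h hp, fun _ => ⟨y, by simp, hyz⟩⟩

theorem linearIndependent_monomial (p : Prop) :
    LinearIndependent K fun t : {t : DotTree X // NormalTree p t} => t.1.monomial K := by
  choose lead hlead c hc using fun t : {t : DotTree X // NormalTree p t} =>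
    exists_leadingTerm (K := K) t.2
  have hinj : Function.Injective lead := fun t t' e =>
    Subtype.ext ((hlead t).injective (hlead t') e)
  have h1 : LinearIndependent K fun i : X ⊕ BaseIndex X => Model.vec K i :=
    Finsupp.linearIndependent_single_one K _
  refine LinearIndependent.of_comp ((keptProj K p).comp (Model.hom K X)) ?_
  have h2 := (h1.comp lead hinj).units_smul c
  convert h2 using 1
  funext t
  exact hc t

end Independence

/-! ### Spanning -/

section Operators

variable {A : Type*} [NonUnitalNonAssocRing A]

theorem polComm_polComm_eq (x y z : A) : polComm x (polComm y z) =
    polComm y (polComm x z) - polComm z (polComm x y) - lieAdmissibleExpr x y z := by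
  simp only [lieAdmissibleExpr, polComm, sub_mul, mul_sub]; abel

/-- The operator of a dot as a linear map. -/
noncomputable def Dot.opMap (K : Type*) [Field K] [Module K A] [IsScalarTower K A A]
    [SMulCommClass K A A] (c : Dot) (a : A) : A →ₗ[K] A where
  toFun := c.op a
  map_add' u v := by
    cases c <;> simp only [Dot.op, polComm, polAnti, mul_add, add_mul] <;> abel
  map_smul' k u := by
    cases c <;>
      simp only [Dot.op, polComm, polAnti, mul_smul_comm, smul_mul_assoc, smul_sub, smul_add,
        RingHom.id_apply]

end Operators

/-! ### Relations in the free algebra -/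

namespace FreeMLieAdm

variable {K X : Type*} [Field K]

theorem lieAdmissibleExpr_eq_zero (a b c : FreeMLieAdm K X) : lieAdmissibleExpr a b c = 0 := by
  obtain ⟨a, rfl⟩ := mk_surjective a
  obtain ⟨b, rfl⟩ := mk_surjective b
  obtain ⟨c, rfl⟩ := mk_surjective c
  have h : mk K (lieAdmissibleExpr a b c) = mk K 0 := by
    rw [mk_eq_mk, sub_zero]
    exact Submodule.mem_sInf.2 fun I hI => hI.1 (.inl ⟨a, b, c, rfl⟩)
  simpa only [lieAdmissibleExpr, map_add, map_sub, mk_mul, map_zero] using h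

theorem mul_mul_mul_eq_zero (a b c d : FreeMLieAdm K X) : (a * b) * (c * d) = 0 := by
  obtain ⟨a, rfl⟩ := mk_surjective a
  obtain ⟨b, rfl⟩ := mk_surjective b
  obtain ⟨c, rfl⟩ := mk_surjective c
  obtain ⟨d, rfl⟩ := mk_surjective d
  have h : mk K (metabelianExpr a b c d) = mk K 0 := by
    rw [mk_eq_mk, sub_zero]
    exact Submodule.mem_sInf.2 fun I hI => hI.1 (.inr ⟨a, b, c, d, rfl⟩)
  simpa only [metabelianExpr, mk_mul, map_zero] using h

theorem jacobi (x y z : FreeMLieAdm K X) : polComm x (polComm y z) =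
    polComm y (polComm x z) - polComm z (polComm x y) := by
  rw [polComm_polComm_eq, lieAdmissibleExpr_eq_zero, sub_zero]

theorem op_mul_op_eq_zero (c c' : Dot) (x y z w : FreeMLieAdm K X) :
    c.op x y * c'.op z w = 0 := by
  cases c <;> cases c' <;>
    simp [Dot.op, polComm, polAnti, add_mul, mul_add, sub_mul, mul_sub, mul_mul_mul_eq_zero]

/-- By Jacobi the two sides differ by a commutator of two elements of the square, which is zero. -/
theorem polComm_polComm_op_comm (c : Dot) (x y a b : FreeMLieAdm K X) :
    polComm x (polComm y (c.op a b)) = polComm y (polComm x (c.op a b)) := by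
  have h : polComm (c.op a b) (polComm x y) = 0 := by
    have h1 : c.op a b * polComm x y = 0 := op_mul_op_eq_zero c Dot.black a b x y
    have h2 : polComm x y * c.op a b = 0 := op_mul_op_eq_zero Dot.black c x y a b
    rw [polComm, h1, h2, sub_zero]
  rw [jacobi, h, sub_zero]

end FreeMLieAdm

open FreeMLieAdm

/-! ### Rewriting monomials into normal trees -/

section Spanning

variable (K : Type*) {X : Type*} [Field K]

theorem DotTree.monomial_cons (e : Dot × X) (d : List (Dot × X)) (z : X) :
    DotTree.monomial K ⟨e :: d, z⟩ = e.1.op (gen K e.2) (DotTree.monomial K ⟨d, z⟩) := rfl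

theorem DotTree.monomial_cons_black (x : X) (d : List (Dot × X)) (z : X) :
    DotTree.monomial K ⟨(Dot.black, x) :: d, z⟩ =
      polComm (gen K x) (DotTree.monomial K ⟨d, z⟩) := rfl

theorem polComm_monomial_comm (x y z : X) {d : List (Dot × X)} (hd : d ≠ []) :
    polComm (gen K x) (polComm (gen K y) (DotTree.monomial K ⟨d, z⟩)) =
      polComm (gen K y) (polComm (gen K x) (DotTree.monomial K ⟨d, z⟩)) := by
  obtain ⟨e, d, rfl⟩ := List.exists_cons_of_ne_nil hd
  exact polComm_polComm_op_comm e.1 _ _ _ _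

/-- As `t` is nonempty, all the operators involved act on the square, so a black dot may be pulled
to the front through a black run. -/
theorem monomial_append_black {u t : List (Dot × X)} (hu : AllBlack u) (ht : t ≠ []) (x z : X) :
    DotTree.monomial K ⟨u ++ (Dot.black, x) :: t, z⟩ =
      polComm (gen K x) (DotTree.monomial K ⟨u ++ t, z⟩) := by
  induction u with
  | nil => rfl
  | cons e u ih =>
    have he := hu e (by simp)
    obtain ⟨c, w⟩ := e
    simp only at he
    subst he
    rw [List.cons_append, List.cons_append, DotTree.monomial_cons_black,
      DotTree.monomial_cons_black, ih fun f hf => hu f (List.mem_cons_of_mem _ hf),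
      polComm_monomial_comm K _ _ _ (by simp [ht])]

theorem monomial_append_jacobi (u : List (Dot × X)) (x y z : X) :
    DotTree.monomial K ⟨u ++ [(Dot.black, x), (Dot.black, y)], z⟩ =
      DotTree.monomial K ⟨u ++ [(Dot.black, y), (Dot.black, x)], z⟩ -
        DotTree.monomial K ⟨u ++ [(Dot.black, z), (Dot.black, x)], y⟩ := by
  induction u with
  | nil => exact jacobi _ _ _
  | cons e u ih =>
    simp only [List.cons_append, DotTree.monomial_cons, ih]
    exact map_sub (e.1.opMap K (gen K e.2)) _ _

variable [LinearOrder X]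

/-- Insertion sort into the first run; it stops at a white dot, where `RunRel` is vacuous. Control
of the head keeps the chain intact in the induction, and the permutation lets later arguments track
the entries. -/
theorem exists_insert_black (x : X) {a t : List (Dot × X)} (ha : RunSorted a) (ht : t ≠ []) :
    ∃ a' : List (Dot × X), a'.Perm ((Dot.black, x) :: a) ∧ RunSorted a' ∧
      (∀ f ∈ a'.head?, f = (Dot.black, x) ∨ f ∈ a.head?) ∧
      ∀ z, DotTree.monomial K ⟨a' ++ t, z⟩ =
        polComm (gen K x) (DotTree.monomial K ⟨a ++ t, z⟩) := by
  induction a with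
  | nil => exact ⟨[(Dot.black, x)], .refl _, by simp, by simp, fun z => rfl⟩
  | cons e a ih =>
    obtain ⟨hhead, hs⟩ := List.isChain_cons.1 ha
    by_cases h : RunRel (Dot.black, x) e
    · refine ⟨(Dot.black, x) :: e :: a, .refl _, List.isChain_cons.2 ⟨?_, ha⟩, by simp,
        fun z => rfl⟩
      intro f hf
      simp at hf
      exact hf ▸ h
    · obtain ⟨a', hp, hs', hh, hm⟩ := ih hs
      obtain ⟨c, w⟩ := e
      simp only [RunRel, true_imp_iff, Classical.not_imp, not_le] at h
      obtain ⟨rfl, hxw⟩ := h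
      refine ⟨(Dot.black, w) :: a', (hp.cons _).trans (.swap _ _ _),
        List.isChain_cons.2 ⟨?_, hs'⟩, by simp, fun z => ?_⟩
      · intro f hf
        rcases hh f hf with rfl | hf
        · exact fun _ _ => hxw.le
        · exact hhead f hf
      · rw [List.cons_append, List.cons_append, DotTree.monomial_cons_black, hm,
          DotTree.monomial_cons_black, polComm_monomial_comm K _ _ _ (by simp [ht])]

/-- The standard black runs, whose monomials form a basis of the square of the free metabelian
Lie algebra. -/
def StandardRun (u : List (Dot × X)) (z : X) : Prop :=
  ∃ v y, u = v ++ [(Dot.black, y)] ∧ AllBlack v ∧ RunSorted v ∧ (∀ e ∈ v, y ≤ e.2) ∧ y < z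

/-- The span of the monomials of the standard black runs of length `n`. -/
noncomputable def standardSpan (X : Type*) [LinearOrder X] (n : ℕ) :
    Submodule K (FreeMLieAdm K X) :=
  Submodule.span K {m | ∃ u z, StandardRun u z ∧ u.length = n ∧ m = DotTree.monomial K ⟨u, z⟩}

theorem polComm_standardRun_of_le {v : List (Dot × X)} {x y z : X} (hv : AllBlack v)
    (hs : RunSorted v) (hle : ∀ e ∈ v, y ≤ e.2) (hyz : y < z) (hyx : y ≤ x) :
    polComm (gen K x) (DotTree.monomial K ⟨v ++ [(Dot.black, y)], z⟩) ∈
      standardSpan K X (v.length + 2) := by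
  obtain ⟨v', hp, hs', -, hm⟩ := exists_insert_black K x (t := [(Dot.black, y)]) hs (by simp)
  rw [← hm]
  refine Submodule.subset_span ⟨_, z, ⟨v', y, rfl, ?_, hs', ?_, hyz⟩, ?_, rfl⟩
  · intro e he
    exact hv.cons rfl e (hp.mem_iff.1 he)
  · intro e he
    rcases List.mem_cons.1 (hp.mem_iff.1 he) with rfl | he
    · exact hyx
    · exact hle e he
  · simp [hp.length_eq]

/-- If `x` is below the minimum `y`, it is moved next to the last bracket, where `[x, [y, z]] = [y,
[x, z]] - [z, [x, y]]`. Now `x` is the innermost minimum, and `y` and `z` are inserted into the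
sorted run. -/
theorem polComm_standardRun {u : List (Dot × X)} {z : X} (h : StandardRun u z) (x : X) :
    polComm (gen K x) (DotTree.monomial K ⟨u, z⟩) ∈ standardSpan K X (u.length + 1) := by
  obtain ⟨v, y, rfl, hv, hs, hle, hyz⟩ := h
  rw [List.length_append, List.length_singleton, add_assoc]
  rcases le_or_gt y x with hyx | hxy
  · exact polComm_standardRun_of_le K hv hs hle hyz hyx
  · have hle' : ∀ e ∈ v, x ≤ e.2 := fun e he => hxy.le.trans (hle e he)
    rw [← monomial_append_black K hv (by simp), monomial_append_jacobi,
      monomial_append_black K (t := [(Dot.black, x)]) hv (by simp) y z,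
      monomial_append_black K (t := [(Dot.black, x)]) hv (by simp) z y]
    exact Submodule.sub_mem _ (polComm_standardRun_of_le K hv hs hle' (hxy.trans hyz) hxy.le)
      (polComm_standardRun_of_le K hv hs hle' hxy (hxy.trans hyz).le)

theorem map_span_le_of_forall {A : Type*} [AddCommGroup A] [Module K A] (f : A →ₗ[K] A)
    {s : Set A} {N : Submodule K A} (h : ∀ m ∈ s, f m ∈ N) {a : A}
    (ha : a ∈ Submodule.span K s) : f a ∈ N :=
  (Submodule.span_le (p := N.comap f)).2 h ha

theorem monomial_mem_standardSpan {u : List (Dot × X)} (hu : AllBlack u) (hne : u ≠ []) (z : X) :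
    DotTree.monomial K ⟨u, z⟩ ∈ standardSpan K X u.length := by
  induction u with
  | nil => exact absurd rfl hne
  | cons e u ih =>
    have he := hu e (by simp)
    obtain ⟨c, x⟩ := e
    simp only at he
    subst he
    have hu' : AllBlack u := fun f hf => hu f (List.mem_cons_of_mem _ hf)
    rcases eq_or_ne u [] with rfl | hne'
    · have key : ∀ x z : X, x < z →
          DotTree.monomial K ⟨[(Dot.black, x)], z⟩ ∈ standardSpan K X 1 := fun x z h =>
        Submodule.subset_span ⟨_, z, ⟨[], x, rfl, by simp [AllBlack], by simp, by simp, h⟩,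
          rfl, rfl⟩
      rcases lt_trichotomy x z with h | rfl | h
      · exact key x z h
      · have : DotTree.monomial K ⟨[(Dot.black, x)], x⟩ = 0 := sub_self _
        rw [this]
        exact Submodule.zero_mem _
      · have : DotTree.monomial K ⟨[(Dot.black, x)], z⟩ =
            -DotTree.monomial K ⟨[(Dot.black, z)], x⟩ := polComm_skew _ _
        rw [this]
        exact Submodule.neg_mem _ (key z x h)
    · refine map_span_le_of_forall K (Dot.opMap K Dot.black (gen K x)) ?_ (ih hu' hne')
      rintro _ ⟨v, w, hv, hl, rfl⟩
      rw [List.length_cons, ← hl]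
      exact polComm_standardRun K hv x

variable (X) in
/-- The span of the monomials of the normal trees. -/
noncomputable def normalSpan (p : Prop) : Submodule K (FreeMLieAdm K X) :=
  Submodule.span K {m | ∃ t : DotTree X, NormalTree p t ∧ m = t.monomial K}

variable (X) in
/-- The span of the monomials of the normal trees with a white dot. -/
noncomputable def whiteSpan (p : Prop) : Submodule K (FreeMLieAdm K X) :=
  Submodule.span K {m | ∃ t : DotTree X, (NormalTree p t ∧ ¬AllBlack t.dots) ∧ m = t.monomial K}

theorem whiteSpan_le (p : Prop) : whiteSpan K X p ≤ normalSpan K X p :=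
  Submodule.span_mono fun _ ⟨t, ht, hm⟩ => ⟨t, ht.1, hm⟩

theorem standardSpan_le {p : Prop} {n : ℕ} : standardSpan K X n ≤ normalSpan K X p := by
  refine Submodule.span_le.2 ?_
  rintro _ ⟨u, z, ⟨v, y, rfl, hv, hs, hle, hyz⟩, -, rfl⟩
  have hu : AllBlack (v ++ [(Dot.black, y)]) := by
    intro e he
    rcases List.mem_append.1 he with he | he
    · exact hv e he
    · rw [List.mem_singleton.1 he]
  have core : ∀ {u : List (Dot × X)} {z : X}, BlackCore p u z →
      DotTree.monomial K ⟨u, z⟩ ∈ normalSpan K X p := fun {u z} h =>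
    Submodule.subset_span ⟨_, .black [] u z (by simp) (by simp [EndsWhite]) h, rfl⟩
  by_cases hp : p ∧ (v ++ [(Dot.black, y)]).length = 2
  · have alt : ∀ x y z : X, y < z → x ≤ z →
        DotTree.monomial K ⟨[(Dot.black, x), (Dot.black, y)], z⟩ ∈ normalSpan K X p := by
      intro x y z hyz hxz
      refine core ⟨by simp, allBlack_pair x y, by simpa [LastLT] using hyz,
        by simpa using fun _ => hxz, fun h => absurd ⟨hp.1, rfl⟩ h⟩
    have hl : v.length = 1 := by simpa using hp.2
    match v, hl with
    | [(c, x)], _ =>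
      have hc := hv (c, x) (by simp)
      simp only at hc
      subst hc
      rcases le_or_gt x z with hxz | hzx
      · exact alt x y z hyz hxz
      -- For `y < z < x`, Jacobi places the largest letter `x` last in both terms, as the
      -- exceptional shape requires.
      · have e : DotTree.monomial K ⟨[(Dot.black, x), (Dot.black, y)], z⟩ =
            DotTree.monomial K ⟨[(Dot.black, z), (Dot.black, y)], x⟩ -
            DotTree.monomial K ⟨[(Dot.black, y), (Dot.black, z)], x⟩ := by
          change polComm (gen K x) (polComm (gen K y) (gen K z)) =
            polComm (gen K z) (polComm (gen K y) (gen K x)) -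
              polComm (gen K y) (polComm (gen K z) (gen K x))
          rw [jacobi, polComm_skew (gen K x) (gen K z), polComm_skew (gen K x) (gen K y),
            polComm_neg_right, polComm_neg_right]
          abel
        rw [List.singleton_append, e]
        exact Submodule.sub_mem _ (alt z y x (hyz.trans hzx) hzx.le)
          (alt y z x hzx (hyz.le.trans hzx.le))
  · refine core ⟨by simp, hu, by simpa [LastLT] using hyz, fun h h' => absurd ⟨h, h'⟩ hp,
      fun _ => List.pairwise_append.2 ⟨hv.runSorted_iff.1 hs, by simp, ?_⟩⟩
    intro e he f hf
    rw [List.mem_singleton.1 hf]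
    exact hle e he

theorem polAnti_mem_whiteSpan {p : Prop} (x : X) {m : FreeMLieAdm K X}
    (hm : m ∈ normalSpan K X p) : polAnti (gen K x) m ∈ whiteSpan K X p := by
  refine map_span_le_of_forall K (Dot.opMap K Dot.white (gen K x)) ?_ hm
  rintro _ ⟨t, ht, rfl⟩
  have hmem : ∀ (x z : X) (d : List (Dot × X)), NormalTree p ⟨(Dot.white, x) :: d, z⟩ →
      DotTree.monomial K ⟨(Dot.white, x) :: d, z⟩ ∈ whiteSpan K X p := fun x z d h => by
    refine Submodule.subset_span ⟨_, ⟨h, fun hb => ?_⟩, rfl⟩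
    have := hb (Dot.white, x) (by simp)
    cases this
  have hcons : ∀ d : List (Dot × X), RunSorted d → RunSorted ((Dot.white, x) :: d) :=
    fun d hd => List.isChain_cons.2 ⟨fun f _ h _ => (by cases h), hd⟩
  cases ht with
  | gen z =>
    rcases le_total x z with h | h
    · exact hmem x z [] (.white [] x z (by simp) h)
    · have : Dot.opMap K Dot.white (gen K x) (DotTree.monomial K ⟨[], z⟩) =
        DotTree.monomial K ⟨[(Dot.white, z)], x⟩ := polAnti_comm _ _
      rw [this]
      exact hmem z x [] (.white [] z x (by simp) h)
  | white d y z hd hyz =>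
    exact hmem x z _ (.white ((Dot.white, x) :: d) y z (hcons d hd) hyz)
  | black a u z hs ha hc =>
    refine hmem x z _ (.black ((Dot.white, x) :: a) u z (hcons a hs) ?_ hc)
    intro e he
    rw [List.getLast?_cons] at he
    cases h : a.getLast? with
    | none => simp [h] at he; rw [← he]
    | some f =>
      simp [h] at he
      exact he ▸ ha f h

/-- In a tree with a white dot, the new black dot is sorted into dots above a white one, so the
final run stays as it is. -/
theorem polComm_mem_whiteSpan {p : Prop} (x : X) {m : FreeMLieAdm K X}
    (hm : m ∈ whiteSpan K X p) : polComm (gen K x) m ∈ whiteSpan K X p := by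
  refine map_span_le_of_forall K (Dot.opMap K Dot.black (gen K x)) ?_ hm
  rintro _ ⟨t, ⟨ht, hw⟩, rfl⟩
  change polComm (gen K x) _ ∈ _
  have hnb : ∀ (d d' : List (Dot × X)) (y : X), ¬AllBlack (d ++ (Dot.white, y) :: d') :=
    fun d d' y h => by
      have := h (Dot.white, y) (by simp)
      cases this
  cases ht with
  | gen z => exact absurd (by simp [AllBlack]) hw
  | white d y z hd hyz =>
    obtain ⟨d', -, hs', -, hm⟩ := exists_insert_black K x (t := [(Dot.white, y)]) hd (by simp)
    rw [← hm]
    exact Submodule.subset_span ⟨_, ⟨.white d' y z hs' hyz, hnb _ _ _⟩, rfl⟩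
  | black a u z hs ha hc =>
    rcases List.eq_nil_or_concat a with rfl | ⟨a, ⟨c, y⟩, rfl⟩
    · exact absurd hc.allBlack hw
    · have hcw : c = Dot.white := ha (c, y) (by simp)
      subst hcw
      rw [List.concat_eq_append] at hs ⊢
      obtain ⟨a', -, hs', -, hm⟩ := exists_insert_black K x (t := (Dot.white, y) :: u)
        (List.isChain_append.1 hs).1 (by simp)
      rw [List.append_assoc, List.singleton_append, ← hm]
      refine Submodule.subset_span ⟨_, ⟨?_, hnb _ _ _⟩, rfl⟩
      have := NormalTree.black (a' ++ [(Dot.white, y)]) u z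
        (List.isChain_append.2 ⟨hs', by simp, fun e _ f hf _ hb => by
          simp at hf
          subst hf
          cases hb⟩) (by simp [EndsWhite]) hc
      simpa using this

/-- A black dot put on an all-black tree changes its final run, so such trees go through standard
runs. The separate claim on `whiteSpan` lets the induction add black dots once a white dot is
present. -/
theorem monomial_mem_normalSpan (p : Prop) (d : List (Dot × X)) (z : X) :
    DotTree.monomial K ⟨d, z⟩ ∈ normalSpan K X p ∧
      (¬AllBlack d → DotTree.monomial K ⟨d, z⟩ ∈ whiteSpan K X p) := by
  induction d with
  | nil => exact ⟨Submodule.subset_span ⟨_, .gen z, rfl⟩, fun h => absurd (by simp [AllBlack]) h⟩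
  | cons e d ih =>
    by_cases hb : AllBlack (e :: d)
    · exact ⟨standardSpan_le K (monomial_mem_standardSpan K hb (by simp) z), fun h => absurd hb h⟩
    · suffices h : DotTree.monomial K ⟨e :: d, z⟩ ∈ whiteSpan K X p from
        ⟨whiteSpan_le K p h, fun _ => h⟩
      obtain ⟨_ | _, x⟩ := e
      · exact polComm_mem_whiteSpan K x (ih.2 fun h => hb (h.cons rfl))
      · exact polAnti_mem_whiteSpan K x ih.1

/-- The span contains the generators and is closed under products: halving recovers products with a
generator from the two coloured operations, and two monomials of degree at least two multiply to
zero. -/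
theorem normalSpan_eq_top [CharZero K] (p : Prop) : normalSpan K X p = ⊤ := by
  have mon : ∀ t : DotTree X, t.monomial K ∈ normalSpan K X p :=
    fun t => (monomial_mem_normalSpan K p t.dots t.last).1
  have half : ∀ a b : FreeMLieAdm K X, polComm a b ∈ normalSpan K X p →
      polAnti a b ∈ normalSpan K X p → a * b ∈ normalSpan K X p ∧ b * a ∈ normalSpan K X p := by
    intro a b hc ha
    have h1 : a * b = (2⁻¹ : K) • (polAnti a b + polComm a b) := by
      simp only [polAnti, polComm]; module
    have h2 : b * a = (2⁻¹ : K) • (polAnti a b - polComm a b) := by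
      simp only [polAnti, polComm]; module
    rw [h1, h2]
    exact ⟨Submodule.smul_mem _ _ (Submodule.add_mem _ ha hc),
      Submodule.smul_mem _ _ (Submodule.sub_mem _ ha hc)⟩
  have gen_mul : ∀ (x : X) (t : DotTree X), gen K x * t.monomial K ∈ normalSpan K X p ∧
      t.monomial K * gen K x ∈ normalSpan K X p := fun x t =>
    half _ _ (mon ⟨(Dot.black, x) :: t.dots, t.last⟩) (mon ⟨(Dot.white, x) :: t.dots, t.last⟩)
  have mul_mon : ∀ t t' : DotTree X, t.monomial K * t'.monomial K ∈ normalSpan K X p := by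
    rintro ⟨_ | ⟨e, d⟩, z⟩ t'
    · exact (gen_mul z t').1
    · obtain ⟨_ | ⟨e', d'⟩, z'⟩ := t'
      · exact (gen_mul z' _).2
      · rw [DotTree.monomial_cons, DotTree.monomial_cons, op_mul_op_eq_zero]
        exact Submodule.zero_mem _
  have mul : ∀ a ∈ normalSpan K X p, ∀ b ∈ normalSpan K X p, a * b ∈ normalSpan K X p := by
    intro a ha b hb
    refine map_span_le_of_forall K (LinearMap.mulRight K b) ?_ ha
    rintro _ ⟨t, -, rfl⟩
    refine map_span_le_of_forall K (LinearMap.mulLeft K (t.monomial K)) ?_ hb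
    rintro _ ⟨t', -, rfl⟩
    exact mul_mon t t'
  refine eq_top_iff.2 fun a _ => ?_
  obtain ⟨a, rfl⟩ := mk_surjective a
  have magma : ∀ m : FreeMagma X, mk K (MonoidAlgebra.single m 1) ∈ normalSpan K X p := by
    intro m
    induction m with
    | ih1 x => exact mon ⟨[], x⟩
    | ih2 m n hm hn =>
      have := mul _ hm _ hn
      rwa [← mk_mul, MonoidAlgebra.single_mul_single, one_mul] at this
  induction a using MonoidAlgebra.induction_linear with
  | zero => rw [map_zero]; exact Submodule.zero_mem _
  | add f g hf hg => rw [map_add]; exact Submodule.add_mem _ (hf trivial) (hg trivial)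
  | single m k =>
    have : MonoidAlgebra.single m k = k • MonoidAlgebra.single m (1 : K) := by
      rw [MonoidAlgebra.smul_single, smul_eq_mul, mul_one]
    rw [this, map_smul]
    exact Submodule.smul_mem _ _ (magma m)

/-- The basis of the free metabelian Lie-admissible algebra given by the normal trees. -/
noncomputable def normalBasis [CharZero K] (p : Prop) :
    Module.Basis {t : DotTree X // NormalTree p t} K (FreeMLieAdm K X) :=
  Module.Basis.mk (linearIndependent_monomial p) (by
    rw [← normalSpan_eq_top K (X := X) p]
    refine Submodule.span_mono ?_
    rintro _ ⟨t, ht, rfl⟩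
    exact ⟨⟨t, ht⟩, rfl⟩)

theorem exists_basis_of_mem_iff [CharZero K] {p : Prop} {s : Set (DotTree X)}
    (h : ∀ t, t ∈ s ↔ NormalTree p t) : ∃ b : Module.Basis s K (FreeMLieAdm K X),
      ∀ t : s, b t = DotTree.monomial K (t : DotTree X) := by
  refine ⟨(normalBasis K p).reindex (Equiv.subtypeEquivRight fun t => (h t).symm), fun t => ?_⟩
  rw [Module.Basis.reindex_apply, normalBasis, Module.Basis.mk_apply]
  rfl

end Spanning

theorem mainTheorem3 (K : Type*) [Field K] [CharZero K] (X : Type*) [LinearOrder X]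
    (r : X → X → Prop) (hr : r = (fun x y => x < y) ∨ r = (fun x y => x > y)) :
    ∃ b : Module.Basis (admissibleTrees r) K (FreeMLieAdm K X),
      ∀ t : admissibleTrees r, b t = DotTree.monomial K (t : DotTree X) := by
  rcases hr with rfl | rfl
  · exact exists_basis_of_mem_iff K mem_admissibleTrees_lt_iff
  · exact exists_basis_of_mem_iff K mem_admissibleTrees_gt_iff
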